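/- **Setting.** Let $\mathbb{H}^3=\{(\zeta,w)\in\mathbb{C}\times\mathbb{R}: w>0\}$ with the metric $(|d\zeta|^2+dw^2)/w^2$, the orientation given by $(\mathrm{Re}\,\zeta,\mathrm{Im}\,\zeta,w)$, and asymptotic boundary $\bar{\mathbb{C}}=\mathbb{C}\cup\{\infty\}$. The direct isometries are identified with $N\mapsto PNP^*$, $P\in SL_2(\mathbb{C})$, through $(\zeta,w)\mapsto \frac1w\begin{pmatrix}1&\bar\zeta\\ \zeta&|\zeta|^2+w^2\end{pmatrix}$. *Cross-ratio.* For $z_1\ne z_4$, $z_2\neq z_3$ in $\bar{\mathbb{C}}$, $(z_1,z_2,z_3,z_4)=\frac{z_3-z_1}{z_3-z_2}\cdot\frac{z_4-z_2}{z_4-z_1}$, with the usual conventions at $\infty$. *Killing fields.* For distinct $\mathcal C,\mathcal D\in\bar{\mathbb C}$, the Killing field $Y$ associated to the translation along (resp. rotation about) the oriented geodesic from $\mathcal C$ to $\mathcal D$ is the generator of the group of translations of distance $t$ along it (resp. rotations of angle $\theta$ about it, in the direct sense); for $(0,\infty)$ these are $(\zeta,w)\mapsto(e^t\zeta,e^tw)$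 and $(\zeta,w)\mapsto(e^{i\theta}\zeta,w)$. *Flux.* An annular end $E$ of a surface of constant mean curvature one is parametrized conformally by a punctured disk. The flux of $Y$ through $E$ is $\varphi=\int_\Gamma\langle\eta,Y\rangle-2\int_K\langle\nu,Y\rangle$, where $\Gamma$ is a closed curve generating $\pi_1(E)$, $K$ a disk in $\mathbb{H}^3$ with boundary $\Gamma$, $\eta$ the unit conormal to $\Gamma$ pointing towards the puncture, $\Gamma$ is oriented so that $(\Gamma',\eta,-\vec H)$ is direct, $\vec H$ being the mean curvature vector, and $\nu$ is the unit normal to $K$ inducing this orientation on $\Gamma$. It does not depend on $\Gamma$ and $K$. *Flux polynomial.* It is $\Pi_E(T)=P_E(T,T)$, where $P_E\in\mathbb{C}[X,Y]$ is the unique polynomial such that for all distinct $\mathcal C,\mathcal D\in\bar{\mathbb C}$ the flux through $E$ of the translation along $(\mathcal C,\mathcal D)$ is $\mathrm{Re}\frac{P_E(\mathcal C,\mathcal D)}{\mathcal C-\mathcal D}$ and that of the rotation about $(\mathcal C,\mathcal D)$ is $-\mathrm{Im}\frac{P_E(\mathcal C,\mathcal D)}{\mathcal C-\mathcal D}$ (limits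 being taken if $\mathcal C$ or $\mathcal D$ is $\infty$). *Catenoidal ends.* Let $\mu\in(0,1)\cup(1,\infty)$. A canonical catenoidal end of growth $1-\mu$ and axis $(0,\infty)$ is the immersion $z\mapsto F(z)F(z)^*$ of $\Omega\setminus\{0\}$, $\Omega$ an open neighbourhood of $0$, where $$F=\begin{pmatrix} z^{\frac{1-\mu}2}f_2&\frac{\mu-1}{\mu+1}z^{\frac{1+\mu}2}g_2\\ \frac{\mu^2-1}{4\mu}z^{\frac{-1-\mu}2}f_1&\frac{(1+\mu)^2}{4\mu}z^{\frac{\mu-1}2}g_1\end{pmatrix},\quad \det F=1,\quad F^{-1}dF=\begin{pmatrix}g&-g^2\\1&-g\end{pmatrix}\omega,$$ $g=z^\mu$, $\omega=z^{-1-\mu}h\,dz$, the functions $f_1,f_2,g_1,g_2,h$ are holomorphic on $\Omega$, $f_1(0)=f_2(0)=g_1(0)=g_2(0)=1$, $f_1'(0)=0$, and $h$ has no zeros. For distinct $\mathcal A,\mathcal B\in\bar{\mathbb C}$, an embedded end $E$ is a catenoidal end of growth $1-\mu$, of asymptotic boundary $\mathcal B$ and of axis $(\mathcal A,\mathcal B)$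 if an isometry of $\mathbb{H}^3$ (direct or not) maps $\mathcal A$ to $0$, $\mathcal B$ to $\infty$ and $E$ to a canonical catenoidal end of growth $1-\mu$ and axis $(0,\infty)$. **Theorem.** Let $\mu\in(0,1)\cup(1,\infty)$, let $\mathcal A,\mathcal B\in\bar{\mathbb C}$ with $\mathcal A\neq\mathcal B$, and let $E$ be a catenoidal end of growth $1-\mu$, of asymptotic boundary $\mathcal B$ and of axis $(\mathcal A,\mathcal B)$. Then for all $\mathcal C\neq\mathcal D$ in $\bar{\mathbb C}$ the flux through $E$ of the Killing field associated to the translation along the geodesic $(\mathcal C,\mathcal D)$ is $$\pi(1-\mu^2)\bigl(2\,\mathrm{Re}(\mathcal A,\mathcal C,\mathcal D,\mathcal B)-1\bigr),$$ the flux through $E$ of the Killing field associated to the rotation about the geodesic $(\mathcal C,\mathcal D)$ is $$-2\pi(1-\mu^2)\,\mathrm{Im}(\mathcal A,\mathcal C,\mathcal D,\mathcal B),$$ and the flux polynomial of $E$ is $$\Pi_E(T)=2\pi(1-\mu^2)\frac{(T-\mathcal A)(T-\mathcal B)}{\mathcal B-\mathcal A},$$ which means $2\pi(1-\mu^2)(T-\mathcal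 B)$ if $\mathcal A=\infty$, and $-2\pi(1-\mu^2)(T-\mathcal A)$ if $\mathcal B=\infty$. -/

import Mathlib

open Real Set Filter Topology Complex
open scoped Matrix ComplexConjugate OnePoint Polynomial

noncomputable section

namespace Bryant

/-! ### Hyperbolic space in the upper half-space model

A point is a pair `(ζ, w) : ℂ × ℝ` with `0 < w`; tangent vectors are pairs in `ℂ × ℝ` too.
The asymptotic boundary is the Riemann sphere `OnePoint ℂ`. -/

/-- The upper half-space. -/
def halfSpace : Set (ℂ × ℝ) := {p | 0 < p.2}

/-- The hyperbolic metric `(|dζ|² + dw²) / w²` at the point `p`. -/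
def hInner (p a b : ℂ × ℝ) : ℝ := ((conj a.1 * b.1).re + a.2 * b.2) / p.2 ^ 2

/-- The hyperbolic norm at the point `p`. -/
def hNorm (p a : ℂ × ℝ) : ℝ := √(hInner p a a)

/-- The Riemannian volume form `(du ∧ dv ∧ dw) / w³` at the point `p`, where `ζ = u + iv`,
for the orientation given by `(u, v, w)`. -/
def hVol (p a b c : ℂ × ℝ) : ℝ :=
  !![a.1.re, a.1.im, a.2; b.1.re, b.1.im, b.2; c.1.re, c.1.im, c.2].det / p.2 ^ 3

/-- The Christoffel symbols of the hyperbolic metric at `p`, as a bilinear map: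
the components of `∇_a b` for constant vector fields `a` and `b`. -/
def christoffel (p a b : ℂ × ℝ) : ℂ × ℝ :=
  (-((a.2 : ℂ) * b.1 + (b.2 : ℂ) * a.1) / (p.2 : ℂ),
    ((conj a.1 * b.1).re - a.2 * b.2) / p.2)

/-- The identification with the Minkowski model, i.e. with the positive definite Hermitian
matrices of determinant one. -/
def toHerm (p : ℂ × ℝ) : Matrix (Fin 2) (Fin 2) ℂ :=
  !![1 / (p.2 : ℂ), conj p.1 / (p.2 : ℂ);
     p.1 / (p.2 : ℂ), ((‖p.1‖ ^ 2 + p.2 ^ 2 : ℝ) : ℂ) / (p.2 : ℂ)]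

/-- The inverse of `toHerm`. On `F * Fᴴ` with `F = !![A, B; C, D]` it gives
`ζ = (conj A * C + conj B * D) / (|A|² + |B|²)` and `w = 1 / (|A|² + |B|²)`. -/
def ofHerm (N : Matrix (Fin 2) (Fin 2) ℂ) : ℂ × ℝ := (N 1 0 / N 0 0, 1 / (N 0 0).re)

/-- The direct isometry `N ↦ P N P*`, for a matrix `P` of determinant one. -/
def act (P : Matrix (Fin 2) (Fin 2) ℂ) (p : ℂ × ℝ) : ℂ × ℝ := ofHerm (P * toHerm p * Pᴴ)

/-- The map `ζ ↦ (δ ζ + γ) / (β ζ + α)` of the Riemann sphere induced by the direct isometry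
given by `P = !![α, β; γ, δ]`. -/
def actBoundary (P : Matrix (Fin 2) (Fin 2) ℂ) : OnePoint ℂ → OnePoint ℂ
  | ∞ => if P 0 1 = 0 then ∞ else ((P 1 1 / P 0 1 : ℂ) : OnePoint ℂ)
  | OnePoint.some z =>
      if P 0 1 * z + P 0 0 = 0 then ∞
      else (((P 1 1 * z + P 1 0) / (P 0 1 * z + P 0 0) : ℂ) : OnePoint ℂ)

/-- Complex conjugation on `ℂ` if `s` is true, the identity otherwise. -/
def conjIf (s : Bool) (z : ℂ) : ℂ := if s then conj z else z

/-- The reflection `(ζ, w) ↦ (conj ζ, w)` if `s` is true, the identity otherwise. Every isometry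
of hyperbolic space is `act P ∘ reflectIf s` for some `P` of determinant one; it is direct if
`s` is false and indirect if `s` is true. -/
def reflectIf (s : Bool) (p : ℂ × ℝ) : ℂ × ℝ := (conjIf s p.1, p.2)

/-- Homogeneous coordinates of a point of the Riemann sphere. -/
def homog : OnePoint ℂ → ℂ × ℂ
  | ∞ => (1, 0)
  | OnePoint.some z => (z, 1)

/-- The difference `z - z'` in homogeneous coordinates; it vanishes if and only if `z = z'`. -/
def bracket (z z' : OnePoint ℂ) : ℂ := (homog z).1 * (homog z').2 - (homog z').1 * (homog z).2

/-- The cross-ratio `(z₃ - z₁) / (z₃ - z₂) * ((z₄ - z₂) / (z₄ - z₁))` of four points of the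
Riemann sphere with `z₁ ≠ z₄` and `z₂ ≠ z₃`, with its usual meaning when some of the points
are infinite. -/
def crossRatio (z₁ z₂ z₃ z₄ : OnePoint ℂ) : ℂ :=
  bracket z₃ z₁ / bracket z₃ z₂ * (bracket z₄ z₂ / bracket z₄ z₁)

/-! ### Killing fields of translations and rotations -/

/-- For `C ≠ D`, the matrix of a direct isometry that maps `C` to `0` and `D` to `∞`. -/
def straighten (C D : OnePoint ℂ) : Matrix (Fin 2) (Fin 2) ℂ :=
  !![-(homog D).1, (homog D).2;
     -(homog C).1 / bracket C D, (homog C).2 / bracket C D]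

theorem bracket_ne_zero {C D : OnePoint ℂ} (h : C ≠ D) : bracket C D ≠ 0 := by
  induction C using OnePoint.rec <;> induction D using OnePoint.rec <;>
    simp_all [bracket, homog, sub_eq_zero]

theorem straighten_det {C D : OnePoint ℂ} (h : C ≠ D) : (straighten C D).det = 1 := by
  have h0 := bracket_ne_zero h
  rw [straighten, Matrix.det_fin_two_of]
  field_simp
  simp only [bracket]
  ring

theorem actBoundary_straighten_left {C D : OnePoint ℂ} (h : C ≠ D) :
    actBoundary (straighten C D) C = ((0 : ℂ) : OnePoint ℂ) := by
  have h0 := bracket_ne_zero h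
  induction C using OnePoint.rec <;> induction D using OnePoint.rec <;>
    simp_all [straighten, actBoundary, bracket, homog]
  · rename_i z z'
    rw [if_neg]
    · field_simp
      simp
    · intro h1
      exact h0 (by linear_combination h1)

theorem actBoundary_straighten_right {C D : OnePoint ℂ} :
    actBoundary (straighten C D) D = ∞ := by
  induction C using OnePoint.rec <;> induction D using OnePoint.rec <;>
    simp_all [straighten, actBoundary, homog]

/-- The translation of distance `t` along the geodesic from `C` to `D`. Along the geodesic from
`0` to `∞` it is `(ζ, w) ↦ (eᵗ ζ, eᵗ w)`. -/
def translation (C D : OnePoint ℂ) (t : ℝ) (p : ℂ × ℝ) : ℂ × ℝ :=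
  act (straighten C D)⁻¹ (Real.exp t • act (straighten C D) p)

/-- The rotation of angle `θ` about the geodesic from `C` to `D`. About the geodesic from
`0` to `∞` it is `(ζ, w) ↦ (e^{iθ} ζ, w)`. -/
def rotation (C D : OnePoint ℂ) (θ : ℝ) (p : ℂ × ℝ) : ℂ × ℝ :=
  act (straighten C D)⁻¹
    (Complex.exp (θ * I) * (act (straighten C D) p).1, (act (straighten C D) p).2)

/-- The Killing field associated to the translation along the geodesic from `C` to `D`. -/
def translationField (C D : OnePoint ℂ) (p : ℂ × ℝ) : ℂ × ℝ :=
  deriv (fun t : ℝ => translation C D t p) 0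

/-- The Killing field associated to the rotation about the geodesic from `C` to `D`. -/
def rotationField (C D : OnePoint ℂ) (p : ℂ × ℝ) : ℂ × ℝ :=
  deriv (fun θ : ℝ => rotation C D θ p) 0

/-! ### Flux of a vector field through an annular end

An annular end is parametrized conformally by a punctured disk, the puncture corresponding to
the asymptotic boundary of the end. -/

/-- The disk of radius `R` punctured at the origin. -/
def puncturedDisk (R : ℝ) : Set ℂ := Metric.ball 0 R \ {0}

/-- The mean curvature vector of a conformal immersion `X` at `z`:
half of the trace of the (vector-valued) second fundamental form, which for a conformal immersion
with conformal factor `λ² = <X_x, X_x>` is `(∇_x X_x + ∇_y X_y) / (2 λ²)`. -/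
def meanCurvatureVector (X : ℂ → ℂ × ℝ) (z : ℂ) : ℂ × ℝ :=
  (1 / (2 * hInner (X z) (fderiv ℝ X z 1) (fderiv ℝ X z 1))) •
    (fderiv ℝ (fun y => fderiv ℝ X y 1) z 1
        + christoffel (X z) (fderiv ℝ X z 1) (fderiv ℝ X z 1)
      + (fderiv ℝ (fun y => fderiv ℝ X y I) z I
        + christoffel (X z) (fderiv ℝ X z I) (fderiv ℝ X z I)))

/-- The objects that enter the definition of the flux through the end parametrized by
`X : puncturedDisk R → halfSpace`: a generator `Γ = X ∘ γ` of the fundamental group of the end,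
its conormal `η`, and a disk `K` with boundary `Γ`, given in polar coordinates `(r, t)`. -/
structure IsFluxData (R : ℝ) (X : ℂ → ℂ × ℝ) (γ : ℝ → ℂ) (η : ℝ → ℂ × ℝ)
    (K : ℝ × ℝ → ℂ × ℝ) (ε : ℤ) : Prop where
  /-- `γ` is a regular closed curve in the punctured disk. -/
  smooth : ContDiff ℝ 2 γ
  periodic : Function.Periodic γ (2 * π)
  regular : ∀ t, deriv γ t ≠ 0
  mem : ∀ t, γ t ∈ puncturedDisk R
  /-- `γ` generates the fundamental group: its winding number `ε` around `0` is `1` or `-1`. -/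
  generator : ε = 1 ∨ ε = -1
  winding : ∫ t in (0 : ℝ)..2 * π, deriv γ t / γ t = ε * (2 * π * I)
  /-- `η` is the unit conormal to `Γ` that points in the direction of the puncture: it is tangent
  to the end, of norm one, orthogonal to `Γ`, and on the left of `Γ` (seen in the punctured disk)
  if `Γ` runs anticlockwise, on its right if `Γ` runs clockwise. -/
  conormal : ∀ t, ∃ v : ℂ, η t = fderiv ℝ X (γ t) v ∧ 0 < ε * (conj (deriv γ t) * v).im
  conormal_unit : ∀ t, hInner (X (γ t)) (η t) (η t) = 1
  conormal_orth : ∀ t, hInner (X (γ t)) (η t) (deriv (X ∘ γ) t) = 0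
  /-- The orientation of `Γ` is such that `(Γ', η, -H)` is direct, where `H` is the mean curvature
  vector. -/
  orientation : ∀ t, 0 < hVol (X (γ t)) (deriv (X ∘ γ) t) (η t) (-meanCurvatureVector X (γ t))
  /-- `K` is a disk in hyperbolic space whose oriented boundary is `Γ`. -/
  disk_smooth : ContDiff ℝ 2 K
  disk_mem : ∀ r ∈ Icc (0 : ℝ) 1, ∀ t, K (r, t) ∈ halfSpace
  disk_periodic : ∀ r t, K (r, t + 2 * π) = K (r, t)
  disk_center : ∀ t, K (0, t) = K (0, 0)
  disk_boundary : ∀ t, K (1, t) = X (γ t)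

/-- The integral `∫_Γ <η, Y>` with respect to arc length, minus twice the integral `∫_K <ν, Y>`
with respect to area. The unit normal `ν` of `K` is the one for which `K` and its boundary `Γ` have
compatible orientations; since `hVol p e₁ e₂ Y = <ν, Y>` for a direct orthonormal basis
`(e₁, e₂, ν)`, `<ν, Y>` times the area element of `K` is `hVol K (∂K/∂r) (∂K/∂t) Y dr dt`. -/
def fluxIntegral (X : ℂ → ℂ × ℝ) (Y : ℂ × ℝ → ℂ × ℝ) (γ : ℝ → ℂ) (η : ℝ → ℂ × ℝ)
    (K : ℝ × ℝ → ℂ × ℝ) : ℝ :=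
  (∫ t in (0 : ℝ)..2 * π,
      hInner (X (γ t)) (η t) (Y (X (γ t))) * hNorm (X (γ t)) (deriv (X ∘ γ) t))
    - 2 * ∫ r in (0 : ℝ)..1, ∫ t in (0 : ℝ)..2 * π,
      hVol (K (r, t)) (fderiv ℝ K (r, t) (1, 0)) (fderiv ℝ K (r, t) (0, 1)) (Y (K (r, t)))

/-- The flux of the vector field `Y` through the end parametrized by `X` on the punctured disk of
radius `R` is well defined (there are a curve and a disk to compute it, and its value does not
depend on them) and is equal to `φ`. -/
def HasFlux (R : ℝ) (X : ℂ → ℂ × ℝ) (Y : ℂ × ℝ → ℂ × ℝ) (φ : ℝ) : Prop :=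
  (∃ γ η K ε, IsFluxData R X γ η K ε) ∧
    ∀ γ η K ε, IsFluxData R X γ η K ε → fluxIntegral X Y γ η K = φ

/-- The two-variable polynomial `P` describes all fluxes through the end: for all distinct `C`, `D`
in the Riemann sphere, the flux of the translation along `(C, D)` is `Re (P(C, D) / (C - D))` and
that of the rotation about `(C, D)` is `-Im (P(C, D) / (C - D))`. When `C` or `D` is infinite,
`P(C, D) / (C - D)` is understood as a limit; when both are finite, the limit is just the value. -/
def DescribesFlux (R : ℝ) (X : ℂ → ℂ × ℝ) (P : MvPolynomial (Fin 2) ℂ) : Prop :=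
  ∀ C D : OnePoint ℂ, C ≠ D → ∃ q : ℂ,
    Tendsto (fun c : ℂ × ℂ => MvPolynomial.eval ![c.1, c.2] P / (c.1 - c.2))
      (comap (fun c : ℂ × ℂ => ((c.1 : OnePoint ℂ), (c.2 : OnePoint ℂ))) (𝓝 (C, D))) (𝓝 q) ∧
    HasFlux R X (translationField C D) q.re ∧ HasFlux R X (rotationField C D) (-q.im)

/-- `Q` is the flux polynomial of the end: `Q(T) = P(T, T)`, where `P` is the
two-variable polynomial that describes the fluxes. -/
def IsFluxPolynomial (R : ℝ) (X : ℂ → ℂ × ℝ) (Q : ℂ[X]) : Prop :=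
  ∃ P : MvPolynomial (Fin 2) ℂ, DescribesFlux R X P ∧
    Q = MvPolynomial.aeval (fun _ : Fin 2 => (Polynomial.X : ℂ[X])) P

/-! ### Catenoidal ends -/

/-- The canonical Bryant representation, as a function of `u = log z` on the universal cover of
the punctured domain, so that `z ^ a` is `exp (a u)`. -/
def canonicalBryantRep (μ : ℝ) (f₁ f₂ g₁ g₂ : ℂ → ℂ) (u : ℂ) : Matrix (Fin 2) (Fin 2) ℂ :=
  !![Complex.exp ((1 - μ) / 2 * u) * f₂ (Complex.exp u),
     (μ - 1) / (μ + 1) * Complex.exp ((1 + μ) / 2 * u) * g₂ (Complex.exp u);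
     (μ ^ 2 - 1) / (4 * μ) * Complex.exp ((-1 - μ) / 2 * u) * f₁ (Complex.exp u),
     (1 + μ) ^ 2 / (4 * μ) * Complex.exp ((μ - 1) / 2 * u) * g₁ (Complex.exp u)]

/-- The matrix one-form `!![g, -g²; 1, -g] ω` with `g = z ^ μ` and `ω = z ^ (-1 - μ) h(z) dz`,
written as a multiple of `du`, where `z = exp u` (so `ω = exp (-μ u) h(exp u) du`). -/
def weierstrassForm (μ : ℝ) (h : ℂ → ℂ) (u : ℂ) : Matrix (Fin 2) (Fin 2) ℂ :=
  (Complex.exp (-μ * u) * h (Complex.exp u)) •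
    !![Complex.exp (μ * u), -Complex.exp (μ * u) ^ 2; 1, -Complex.exp (μ * u)]

/-- The immersion `X` of `Ω \ {0}` is a canonical catenoidal end of growth `1 - μ`, of asymptotic
boundary `∞` and of axis `(Z, ∞)`: it is `F * Fᴴ` where `F` has determinant one, has the canonical
form, and solves Bryant's equation `F⁻¹ dF = !![g, -g²; 1, -g] ω`. -/
def IsCanonicalCatenoidalEnd (μ : ℝ) (Z : ℂ) (Ω : Set ℂ) (X : ℂ → ℂ × ℝ) : Prop :=
  IsOpen Ω ∧ (0 : ℂ) ∈ Ω ∧ ∃ f₁ f₂ g₁ g₂ h : ℂ → ℂ,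
    (DifferentiableOn ℂ f₁ Ω ∧ DifferentiableOn ℂ f₂ Ω ∧ DifferentiableOn ℂ g₁ Ω ∧
      DifferentiableOn ℂ g₂ Ω ∧ DifferentiableOn ℂ h Ω) ∧
    (f₁ 0 = 1 ∧ f₂ 0 = 1 ∧ g₁ 0 = 1 ∧ g₂ 0 = 1 ∧ ∀ z ∈ Ω, h z ≠ 0) ∧
    Z = (μ ^ 2 - 1) / (4 * μ) * deriv f₁ 0 ∧
    ∀ u : ℂ, Complex.exp u ∈ Ω →
      (canonicalBryantRep μ f₁ f₂ g₁ g₂ u).det = 1 ∧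
      (∀ i j, HasDerivAt (fun v => canonicalBryantRep μ f₁ f₂ g₁ g₂ v i j)
        ((canonicalBryantRep μ f₁ f₂ g₁ g₂ u * weierstrassForm μ h u) i j) u) ∧
      X (Complex.exp u) =
        ofHerm (canonicalBryantRep μ f₁ f₂ g₁ g₂ u * (canonicalBryantRep μ f₁ f₂ g₁ g₂ u)ᴴ)

/-- The embedded end `E` parametrized by `X` on the punctured disk of radius `R` is a catenoidal
end of growth `1 - μ`, of asymptotic boundary `B` and of axis `(A, B)`: some isometry `Ψ`, direct
or not, maps `A` to `0`, `B` to `∞` and `E` to a canonical catenoidal end `X₀` of growth `1 - μ` and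
axis `(0, ∞)`. The change of parameter `ψ` from the disk to the domain of `X₀` fixes the puncture; it
is holomorphic if `Ψ` is direct and antiholomorphic if `Ψ` is indirect (that is, `X`, like `X₀`, is
conformal and compatible with the orientation given by the mean curvature vector).
That `X` is a conformal immersion of constant mean curvature one with finite total curvature, not
contained in a horosphere, follows from the form of the canonical end. -/
def IsCatenoidalEnd (μ : ℝ) (A B : OnePoint ℂ) (R : ℝ) (X : ℂ → ℂ × ℝ) : Prop :=
  MapsTo X (puncturedDisk R) halfSpace ∧
  IsEmbedding (fun z : puncturedDisk R => X z) ∧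
  ∃ (P : Matrix (Fin 2) (Fin 2) ℂ) (s : Bool) (ψ : ℂ → ℂ) (X₀ : ℂ → ℂ × ℝ),
    P.det = 1 ∧
    actBoundary P (A.map (conjIf s)) = ((0 : ℂ) : OnePoint ℂ) ∧
    actBoundary P (B.map (conjIf s)) = ∞ ∧
    ψ 0 = 0 ∧ InjOn ψ (Metric.ball 0 R) ∧
    DifferentiableOn ℂ (fun z => conjIf s (ψ z)) (Metric.ball 0 R) ∧
    IsCanonicalCatenoidalEnd μ 0 (ψ '' Metric.ball 0 R) X₀ ∧
    ∀ z ∈ puncturedDisk R, act P (reflectIf s (X z)) = X₀ (ψ z)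

/-- The polynomial `2π (1 - μ²) (T - A) (T - B) / (B - A)`, which means `2π (1 - μ²) (T - B)` if
`A = ∞` and `-2π (1 - μ²) (T - A)` if `B = ∞`. -/
def catenoidalPolynomial (μ : ℝ) : OnePoint ℂ → OnePoint ℂ → ℂ[X]
  | OnePoint.some a, OnePoint.some b =>
      Polynomial.C (2 * π * (1 - μ ^ 2) / (b - a) : ℂ) *
        ((Polynomial.X - Polynomial.C a) * (Polynomial.X - Polynomial.C b))
  | ∞, OnePoint.some b =>
      Polynomial.C (2 * π * (1 - μ ^ 2) : ℂ) * (Polynomial.X - Polynomial.C b)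
  | OnePoint.some a, ∞ =>
      Polynomial.C (-(2 * π * (1 - μ ^ 2)) : ℂ) * (Polynomial.X - Polynomial.C a)
  | ∞, ∞ => 0

end Bryant

end

noncomputable section

namespace Bryant

/-! ### The action of `SL(2, ℂ)` and its Killing fields -/

/-! The flux is a residue. Let `F` be the Bryant representation and `M = F' F⁻¹`. For `X = F Fᴴ` the
vector `dX(v)` is the value at `X` of the Killing field generated by `M v`, and `M` is nilpotent
with holomorphic entries; it is single-valued on the punctured disk although `F` is not
(`IsNullImmersion`, `isNullImmersion_of_logDeriv`).

Let `Y` be the Killing field generated by a traceless matrix `N`. By conformality the conormal times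
arc length is `-dX(i γ')`, and the integral of `Y` over the disk becomes a boundary integral,
because the interior product of the volume form with `Y` has the explicit primitive `volPrimitive`.
The resulting integrand on `Γ` is `2 Im tr(N M) dz` plus an exact form (`flux_integrand_eq`), so the
flux is `2 Im ∫ tr(N M) dz` (`IsNullImmersion.fluxIntegral_eq`). The mean curvature convention makes
the curve run clockwise.

For a canonical end, `M = !![a, w b; c / w, -a] dw / w` with `a`, `b`, `c` holomorphic, `a(0) = (1 -
μ²) / 4` and `c'(0) = 0` (`IsCanonicalCatenoidalEnd.exists_logDeriv`); the last equality is the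
normalization `f₁'(0) = 0` of the axis. The residue of `M` is therefore diagonal. If `P` moves the
end to canonical position, only the upper left entry `n` of `P N P⁻¹` contributes, and the flux is
`-2π (1 - μ²) Re n`.

For the translation along `(C, D)`, `n` is `1/2` minus the cross-ratio of `A, C, D, B`
(`conj_generator_eq_crossRatio`); the rotation has generator `i` times that of the translation,
which replaces the real part by an imaginary part. Multiplying by `C - D` turns the formula into a
polynomial in `C` and `D`. Any other polynomial describing the fluxes agrees with it off the
diagonal, hence on the diagonal by continuity. -/

/-- The Killing field generated by the matrix `!![a, b; c, -a]`. -/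
def killing (a b c : ℂ) (p : ℂ × ℝ) : ℂ × ℝ :=
  (c - 2 * a * p.1 - b * p.1 ^ 2 + conj b * (p.2 : ℂ) ^ 2, -2 * p.2 * (a + b * p.1).re)

theorem ofHerm_toHerm {p : ℂ × ℝ} (hp : 0 < p.2) : ofHerm (toHerm p) = p := by
  have h : (p.2 : ℂ) ≠ 0 := by exact_mod_cast hp.ne'
  ext1
  · simp [ofHerm, toHerm]
    field_simp
  · simp [ofHerm, toHerm, ← Complex.ofReal_inv]

theorem row_normSq_pos {G : Matrix (Fin 2) (Fin 2) ℂ} (hG : G.det = 1) :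
    0 < normSq (G 0 0) + normSq (G 0 1) := by
  rw [Matrix.det_fin_two] at hG
  by_cases h : G 0 0 = 0
  · have : G 0 1 ≠ 0 := by
      rintro h'
      simp [h, h'] at hG
    linarith [normSq_nonneg (G 0 0), normSq_pos.2 this]
  · linarith [normSq_nonneg (G 0 1), normSq_pos.2 h]

theorem mul_conjTranspose_apply_zero_zero (G : Matrix (Fin 2) (Fin 2) ℂ) :
    (G * Gᴴ) 0 0 = ((normSq (G 0 0) + normSq (G 0 1) : ℝ) : ℂ) := by
  simp [Matrix.mul_apply, Matrix.conjTranspose_apply, Complex.mul_conj]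

theorem ofHerm_mul_conjTranspose_mem {G : Matrix (Fin 2) (Fin 2) ℂ} (hG : G.det = 1) :
    0 < (ofHerm (G * Gᴴ)).2 := by
  have h := row_normSq_pos hG
  simp only [ofHerm, mul_conjTranspose_apply_zero_zero, Complex.ofReal_re]
  positivity

/-- A Hermitian matrix of determinant one with nonzero upper left entry is determined by its first
column: symmetry gives the entry `0 1` and the determinant gives the entry `1 1`. -/
theorem toHerm_ofHerm {G : Matrix (Fin 2) (Fin 2) ℂ} (hG : G.det = 1) :
    toHerm (ofHerm (G * Gᴴ)) = G * Gᴴ := by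
  have h := row_normSq_pos hG
  have hne : ((normSq (G 0 0) + normSq (G 0 1) : ℝ) : ℂ) ≠ 0 := by exact_mod_cast h.ne'
  have h00 := mul_conjTranspose_apply_zero_zero G
  have hH : (G * Gᴴ) 0 1 = conj ((G * Gᴴ) 1 0) := by
    simp [Matrix.mul_apply, Matrix.conjTranspose_apply, mul_comm]
  have hdet : (G * Gᴴ) 0 0 * (G * Gᴴ) 1 1 - (G * Gᴴ) 0 1 * (G * Gᴴ) 1 0 = 1 := by
    rw [← Matrix.det_fin_two, Matrix.det_mul, Matrix.det_conjTranspose, hG]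
    simp
  generalize G * Gᴴ = N at *
  generalize normSq (G 0 0) + normSq (G 0 1) = n at *
  rw [hH, h00] at hdet
  have h11 : N 1 1 = (1 + conj (N 1 0) * N 1 0) / n := by
    field_simp
    linear_combination hdet
  have hnorm : ((‖N 1 0 / (n : ℂ)‖ ^ 2 : ℝ) : ℂ) = conj (N 1 0) * N 1 0 / n ^ 2 := by
    rw [← Complex.normSq_eq_norm_sq, Complex.normSq_eq_conj_mul_self]
    simp
    field_simp
  ext i j
  fin_cases i <;> fin_cases j
  · simp [toHerm, ofHerm, h00]
  · simp [toHerm, ofHerm, h00, hH]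
    field_simp
  · simp [toHerm, ofHerm, h00]
    field_simp
  · simp only [toHerm, ofHerm, h00, Complex.ofReal_re, Complex.ofReal_add, hnorm]
    simp
    field_simp
    linear_combination -hdet

/-- The lower triangular matrix `G` with `G * Gᴴ = toHerm p`. -/
def hermRoot (p : ℂ × ℝ) : Matrix (Fin 2) (Fin 2) ℂ :=
  !![1 / (√p.2 : ℂ), 0; p.1 / (√p.2 : ℂ), (√p.2 : ℂ)]

theorem hermRoot_det {p : ℂ × ℝ} (hp : 0 < p.2) : (hermRoot p).det = 1 := by
  have h : (√p.2 : ℂ) ≠ 0 := by exact_mod_cast (Real.sqrt_pos.2 hp).ne'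
  rw [hermRoot, Matrix.det_fin_two_of]
  field_simp
  simp

theorem hermRoot_mul_conjTranspose {p : ℂ × ℝ} (hp : 0 < p.2) :
    hermRoot p * (hermRoot p)ᴴ = toHerm p := by
  have h : (√p.2 : ℂ) ≠ 0 := by exact_mod_cast (Real.sqrt_pos.2 hp).ne'
  have hw : (p.2 : ℂ) = (√p.2 : ℂ) ^ 2 := by exact_mod_cast (Real.sq_sqrt hp.le).symm
  have hn : ((‖p.1‖ ^ 2 : ℝ) : ℂ) = p.1 * conj p.1 := by
    rw [← Complex.normSq_eq_norm_sq, Complex.mul_conj]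
  ext i j
  fin_cases i <;> fin_cases j <;>
    simp only [hermRoot, toHerm, Complex.ofReal_add, hn, hw, Complex.ofReal_pow,
      Matrix.mul_apply, Fin.sum_univ_two, Matrix.conjTranspose_apply] <;>
    simp <;> field_simp

/-- Factoring `toHerm p` through `hermRoot p` puts `P * toHerm p * Pᴴ` back in the form `G * Gᴴ`
with `det G = 1`, where `ofHerm` loses no information. This is what lets actions be composed as
matrix products. -/
theorem toHerm_act {P : Matrix (Fin 2) (Fin 2) ℂ} (hP : P.det = 1) {p : ℂ × ℝ} (hp : 0 < p.2) :
    toHerm (act P p) = P * toHerm p * Pᴴ := by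
  have h : P * toHerm p * Pᴴ = (P * hermRoot p) * (P * hermRoot p)ᴴ := by
    rw [← hermRoot_mul_conjTranspose hp, Matrix.conjTranspose_mul]
    simp only [Matrix.mul_assoc]
  rw [act, h, toHerm_ofHerm (by rw [Matrix.det_mul, hP, hermRoot_det hp, one_mul])]

theorem act_mem {P : Matrix (Fin 2) (Fin 2) ℂ} (hP : P.det = 1) {p : ℂ × ℝ} (hp : 0 < p.2) :
    0 < (act P p).2 := by
  have h : P * toHerm p * Pᴴ = (P * hermRoot p) * (P * hermRoot p)ᴴ := by
    rw [← hermRoot_mul_conjTranspose hp, Matrix.conjTranspose_mul]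
    simp only [Matrix.mul_assoc]
  rw [act, h]
  exact ofHerm_mul_conjTranspose_mem (by rw [Matrix.det_mul, hP, hermRoot_det hp, one_mul])

section Derivative

variable {E : Type*} [NormedAddCommGroup E] [NormedSpace ℝ E]

/-- If `G' = !![a, b; c, -a] * G`, the derivative of the point `G * Gᴴ` of hyperbolic space is
the value of the Killing field generated by `!![a, b; c, -a]`. -/
theorem hasFDerivAt_ofHerm_mul_conjTranspose {G : E → Matrix (Fin 2) (Fin 2) ℂ}
    {LG : Fin 2 → Fin 2 → E →L[ℝ] ℂ} {x : E} {p : ℂ × ℝ} {L : E →L[ℝ] ℂ × ℝ} (hp : 0 < p.2)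
    (hG : ∀ i j, HasFDerivAt (fun y => G y i j) (LG i j) x) (hGp : G x * (G x)ᴴ = toHerm p)
    (hL : ∀ v, ∃ a b c, L v = killing a b c p ∧
      ∀ i j, LG i j v = (!![a, b; c, -a] * G x) i j) :
    HasFDerivAt (fun y => ofHerm (G y * (G y)ᴴ)) L x := by
  have hw : (p.2 : ℂ) ≠ 0 := by exact_mod_cast hp.ne'
  have hconj : ∀ i j, HasFDerivAt (fun y => conj (G y i j))
      (conjCLE.toContinuousLinearMap.comp (LG i j)) x := fun i j =>
    conjCLE.toContinuousLinearMap.hasFDerivAt.comp x (hG i j)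
  have h00 := congrFun (congrFun hGp 0) 0
  have h10 := congrFun (congrFun hGp 1) 0
  have h01 := congrFun (congrFun hGp 0) 1
  have h11 := congrFun (congrFun hGp 1) 1
  simp only [Matrix.mul_apply, Fin.sum_univ_two, Matrix.conjTranspose_apply, toHerm,
    RCLike.star_def, Matrix.of_apply, Matrix.cons_val', Matrix.cons_val_zero,
    Matrix.cons_val_one, Matrix.cons_val_fin_one] at h00 h10 h01 h11
  have hn : ((‖p.1‖ ^ 2 + p.2 ^ 2 : ℝ) : ℂ) = p.1 * conj p.1 + (p.2 : ℂ) ^ 2 := by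
    rw [← Complex.normSq_eq_norm_sq, Complex.mul_conj]
    push_cast
    rfl
  rw [hn] at h11
  choose a b c hv hLG using hL
  have hr : ∀ v, ((2 * (a v + b v * p.1).re : ℝ) : ℂ)
      = a v + b v * p.1 + conj (a v + b v * p.1) := by
    intro v
    rw [Complex.add_conj]
  -- With `N = G * Gᴴ` and `M = !![a, b; c, -a]`, one has `N' = M N + N Mᴴ`. Since `ofHerm` reads
  -- only the first column of `N`, the derivatives `D0` and `D1` of its two entries suffice.
  obtain ⟨D0, d0, hD0⟩ : ∃ D0 : E →L[ℝ] ℂ,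
      HasFDerivAt (fun y => G y 0 0 * conj (G y 0 0) + G y 0 1 * conj (G y 0 1)) D0 x ∧
      ∀ v, D0 v = ((2 * (a v + b v * p.1).re : ℝ) : ℂ) / p.2 := by
    refine ⟨_, ((hG 0 0).mul (hconj 0 0)).add ((hG 0 1).mul (hconj 0 1)), fun v => ?_⟩
    simp only [add_apply, smul_apply,
      ContinuousLinearMap.comp_apply, smul_eq_mul, ContinuousLinearEquiv.coe_coe, conjCLE_apply]
    rw [hLG, hLG, hr]
    simp only [Matrix.mul_apply, Fin.sum_univ_two, Matrix.of_apply, Matrix.cons_val',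
      Matrix.cons_val_zero, Matrix.cons_val_one, Matrix.cons_val_fin_one, map_add, map_mul]
    linear_combination a v * h00 + b v * h10 + conj (a v) * h00 + conj (b v) * h01
  obtain ⟨D1, d1, hD1⟩ : ∃ D1 : E →L[ℝ] ℂ,
      HasFDerivAt (fun y => G y 1 0 * conj (G y 0 0) + G y 1 1 * conj (G y 0 1)) D1 x ∧
      ∀ v, D1 v = (c v - a v * p.1 + conj (a v) * p.1 +
        conj (b v) * (p.1 * conj p.1 + p.2 ^ 2)) / p.2 := by
    refine ⟨_, ((hG 1 0).mul (hconj 0 0)).add ((hG 1 1).mul (hconj 0 1)), fun v => ?_⟩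
    simp only [add_apply, smul_apply,
      ContinuousLinearMap.comp_apply, smul_eq_mul, ContinuousLinearEquiv.coe_coe, conjCLE_apply]
    rw [hLG, hLG, hLG, hLG]
    simp only [Matrix.mul_apply, Fin.sum_univ_two, Matrix.of_apply, Matrix.cons_val',
      Matrix.cons_val_zero, Matrix.cons_val_one, Matrix.cons_val_fin_one, map_add, map_mul]
    linear_combination c v * h00 - a v * h10 + conj (a v) * h10 + conj (b v) * h11
  have dre := reCLM.hasFDerivAt.comp x d0
  have hre : (G x 0 0 * conj (G x 0 0) + G x 0 1 * conj (G x 0 1)).re = 1 / p.2 := by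
    rw [h00, ← Complex.ofReal_one, ← Complex.ofReal_div]; simp
  have e1 := d1.mul ((hasFDerivAt_inv' (𝕜 := ℝ) (by rw [h00]; exact one_div_ne_zero hw)).comp x d0)
  have e2 := (hasFDerivAt_inv' (𝕜 := ℝ) (by
    simp only [Function.comp_apply, reCLM_apply, hre]; positivity)).comp x dre
  refine ((e1.prodMk e2).congr_fderiv ?_).congr_of_eventuallyEq (Eventually.of_forall fun y => ?_)
  · ext1 v
    rw [hv]
    refine Prod.ext ?_ ?_
    · have hD0' := hD0 v
      rw [hr] at hD0'
      simp [killing, hD0', hD1, h00, h10]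
      field_simp
      ring
    · have : D0 v = ((2 * (a v + b v * p.1).re / p.2 : ℝ) : ℂ) := by
        rw [hD0]; push_cast; rfl
      simp [-Complex.ofReal_mul, -Complex.ofReal_div, killing, this, hre]
      field_simp
  · simp [ofHerm, Matrix.mul_apply, Matrix.conjTranspose_apply, div_eq_mul_inv]

end Derivative

/-- The loxodromic isometry `(ζ, w) ↦ (exp τ * ζ, exp (re τ) * w)` with axis `(0, ∞)`. -/
def loxodromic (τ : ℂ) : Matrix (Fin 2) (Fin 2) ℂ :=
  !![Complex.exp (-τ / 2), 0; 0, Complex.exp (τ / 2)]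

theorem loxodromic_det (τ : ℂ) : (loxodromic τ).det = 1 := by
  rw [loxodromic, Matrix.det_fin_two_of, ← Complex.exp_add]
  simp [neg_div]

theorem act_loxodromic (τ : ℂ) {p : ℂ × ℝ} (hp : 0 < p.2) :
    act (loxodromic τ) p = (Complex.exp τ * p.1, Real.exp τ.re * p.2) := by
  have hw : (p.2 : ℂ) ≠ 0 := by exact_mod_cast hp.ne'
  have h : toHerm (Complex.exp τ * p.1, Real.exp τ.re * p.2) =
      loxodromic τ * toHerm p * (loxodromic τ)ᴴ := by
    have e0 : Complex.exp (τ / 2) ≠ 0 := Complex.exp_ne_zero _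
    have e1 : (Real.exp τ.re : ℂ) = Complex.exp (τ / 2) * conj (Complex.exp (τ / 2)) := by
      rw [Complex.mul_conj, Complex.normSq_eq_norm_sq, Complex.norm_exp, ← Real.exp_nat_mul]
      congr 2
      simp
      ring
    have e2 : Complex.exp τ = Complex.exp (τ / 2) ^ 2 := by
      rw [← Complex.exp_nat_mul]
      congr 1
      push_cast
      ring
    have e3 : Complex.exp (-τ / 2) = (Complex.exp (τ / 2))⁻¹ := by
      rw [← Complex.exp_neg, neg_div]
    have hn : ∀ z : ℂ, ((‖z‖ ^ 2 : ℝ) : ℂ) = z * conj z := fun z => by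
      rw [← Complex.normSq_eq_norm_sq, Complex.mul_conj]
    have hc : conj (Complex.exp (τ / 2)) ≠ 0 := by simp
    ext i j
    fin_cases i <;> fin_cases j <;>
      simp only [toHerm, Complex.ofReal_add, hn, Complex.ofReal_pow, Complex.ofReal_mul, e1, e2, e3,
        loxodromic, Matrix.mul_apply, Fin.sum_univ_two, Matrix.conjTranspose_apply, map_mul,
        map_pow, RCLike.star_def] <;>
      simp <;> field_simp
  rw [act, ← h, ofHerm_toHerm (by positivity)]


/-- One-parameter groups of loxodromic isometries with a given axis have Killing fields as
generators. -/
theorem deriv_act_conj_loxodromic {S : Matrix (Fin 2) (Fin 2) ℂ} (hS : S.det = 1) (κ : ℂ)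
    {p : ℂ × ℝ} (hp : 0 < p.2) :
    deriv (fun t : ℝ => act S⁻¹ (act (loxodromic (κ * t)) (act S p))) 0 =
      killing (κ * -((S 0 0 * S 1 1 + S 0 1 * S 1 0) / 2)) (κ * -(S 0 1 * S 1 1))
        (κ * (S 0 0 * S 1 0)) p := by
  have hSinv : S⁻¹ = !![S 1 1, -S 0 1; -S 1 0, S 0 0] := by
    rw [Matrix.inv_def, hS, Ring.inverse_one, one_smul, Matrix.adjugate_fin_two]
  set G : ℝ → Matrix (Fin 2) (Fin 2) ℂ :=
    fun t => S⁻¹ * loxodromic (κ * t) * S * hermRoot p with hGdef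
  have hact : ∀ t : ℝ, act S⁻¹ (act (loxodromic (κ * t)) (act S p)) = ofHerm (G t * (G t)ᴴ) := by
    intro t
    rw [act, toHerm_act (loxodromic_det _) (act_mem hS hp), toHerm_act hS hp,
      ← hermRoot_mul_conjTranspose hp, hGdef]
    simp only [Matrix.conjTranspose_mul, Matrix.mul_assoc]
  have hG0 : G 0 = hermRoot p := by
    have : loxodromic (κ * (0 : ℝ)) = 1 := by
      ext i j
      fin_cases i <;> fin_cases j <;> simp [loxodromic]
    simp only [hGdef, this, mul_one]
    rw [Matrix.nonsing_inv_mul _ (by rw [hS]; exact isUnit_one), one_mul]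
  -- The generator is `κ S⁻¹ diag(-1/2, 1/2) S`, written out with the adjugate formula for `S⁻¹`.
  have hL : ∀ i j, ∃ l : ℝ →L[ℝ] ℂ, HasFDerivAt (fun t => G t i j) l 0 ∧
      ∀ v : ℝ, l v = (!![v * (κ * -((S 0 0 * S 1 1 + S 0 1 * S 1 0) / 2)),
        v * (κ * -(S 0 1 * S 1 1)); v * (κ * (S 0 0 * S 1 0)),
        -(v * (κ * -((S 0 0 * S 1 1 + S 0 1 * S 1 0) / 2)))] * hermRoot p) i j := by
    have d1 : HasDerivAt (fun t : ℝ => Complex.exp (-(κ * t) / 2)) (-κ / 2) 0 := by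
      have : HasDerivAt (fun t : ℝ => -(κ * (t : ℂ)) / 2) (-(κ * 1) / 2) 0 :=
        (((Complex.ofRealCLM.hasDerivAt (x := 0)).const_mul κ).neg).div_const 2
      simpa using this.cexp
    have d2 : HasDerivAt (fun t : ℝ => Complex.exp (κ * t / 2)) (κ / 2) 0 := by
      have : HasDerivAt (fun t : ℝ => κ * (t : ℂ) / 2) (κ * 1 / 2) 0 :=
        ((Complex.ofRealCLM.hasDerivAt (x := 0)).const_mul κ).div_const 2
      simpa using this.cexp
    have hGt : ∀ i j, (fun t => G t i j) = fun t : ℝ =>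
        Complex.exp (-(κ * t) / 2) * (S⁻¹ i 0 * (S * hermRoot p) 0 j) +
          Complex.exp (κ * t / 2) * (S⁻¹ i 1 * (S * hermRoot p) 1 j) := by
      intro i j
      funext t
      simp only [hGdef, Matrix.mul_assoc S⁻¹, Matrix.mul_assoc (loxodromic _)]
      simp only [Matrix.mul_apply (M := S⁻¹), Matrix.mul_apply (M := loxodromic _),
        Fin.sum_univ_two]
      simp [loxodromic]
      ring
    intro i j
    have := ((d1.mul_const (S⁻¹ i 0 * (S * hermRoot p) 0 j)).add
      (d2.mul_const (S⁻¹ i 1 * (S * hermRoot p) 1 j)))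
    refine ⟨_, by rw [hGt]; exact this.hasFDerivAt, fun v => ?_⟩
    simp only [ContinuousLinearMap.toSpanSingleton_apply, hSinv, Matrix.mul_apply, Fin.sum_univ_two]
    fin_cases i <;> fin_cases j <;> simp <;> ring
  choose l hl hlv using hL
  have key : HasFDerivAt (fun t => ofHerm (G t * (G t)ᴴ)) (ContinuousLinearMap.toSpanSingleton ℝ
      (killing (κ * -((S 0 0 * S 1 1 + S 0 1 * S 1 0) / 2)) (κ * -(S 0 1 * S 1 1))
        (κ * (S 0 0 * S 1 0)) p)) 0 := by
    refine hasFDerivAt_ofHerm_mul_conjTranspose hp hl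
      (by rw [hG0, hermRoot_mul_conjTranspose hp]) fun v => ⟨_, _, _, ?_,
      fun i j => (hlv i j v).trans (by rw [hG0])⟩
    refine Prod.ext ?_ ?_
    · simp [killing]
      ring
    · simp [killing]
      ring
  simp only [hact]
  exact key.hasDerivAt.deriv.trans (by simp)

/-- Translations are the case `κ = 1` and rotations the case `κ = I` of the same complex
one-parameter group. The two generators therefore differ by the factor `I`, and the two fluxes are
governed by one complex number. -/
theorem translationField_eq {C D : OnePoint ℂ} (h : C ≠ D) {p : ℂ × ℝ} (hp : 0 < p.2) :
    translationField C D p =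
      killing (-((straighten C D 0 0 * straighten C D 1 1 +
        straighten C D 0 1 * straighten C D 1 0) / 2))
        (-(straighten C D 0 1 * straighten C D 1 1))
        (straighten C D 0 0 * straighten C D 1 0) p := by
  have := deriv_act_conj_loxodromic (straighten_det h) 1 hp
  simp only [one_mul] at this
  have e : ∀ t : ℝ, translation C D t p = act (straighten C D)⁻¹
      (act (loxodromic t) (act (straighten C D) p)) := fun t => by
    rw [act_loxodromic _ (act_mem (straighten_det h) hp), translation]
    congr 1
    ext1 <;> simp
  rw [← this, translationField]
  simp only [e]

theorem rotationField_eq {C D : OnePoint ℂ} (h : C ≠ D) {p : ℂ × ℝ} (hp : 0 < p.2) :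
    rotationField C D p =
      killing (I * -((straighten C D 0 0 * straighten C D 1 1 +
        straighten C D 0 1 * straighten C D 1 0) / 2))
        (I * -(straighten C D 0 1 * straighten C D 1 1))
        (I * (straighten C D 0 0 * straighten C D 1 0)) p := by
  have := deriv_act_conj_loxodromic (straighten_det h) I hp
  have e : ∀ t : ℝ, rotation C D t p = act (straighten C D)⁻¹
      (act (loxodromic (I * t)) (act (straighten C D) p)) := fun t => by
    rw [act_loxodromic _ (act_mem (straighten_det h) hp), rotation, mul_comm I]
    simp
  rw [← this, rotationField]
  simp only [e]

/-! ### Immersions tangent to a nilpotent family of Killing fields -/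

theorem killing_mul (a b c v : ℂ) (p : ℂ × ℝ) :
    killing (a * v) (b * v) (c * v) p =
      ((c - 2 * a * p.1 - b * p.1 ^ 2) * v + conj (b * v) * (p.2 : ℂ) ^ 2,
        -2 * p.2 * ((a + b * p.1) * v).re) := by
  simp only [killing]
  refine Prod.ext ?_ ?_
  · ring
  · ring_nf

/-- The value at `p` of the Killing fields generated by the multiples of `!![a, b; c, -a]`. -/
def killingCLM (a b c : ℂ) (p : ℂ × ℝ) : ℂ →L[ℝ] ℂ × ℝ :=
  LinearMap.toContinuousLinearMap
    { toFun := fun v => killing (a * v) (b * v) (c * v) p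
      map_add' := fun u v => by
        refine Prod.ext ?_ ?_ <;> simp [killing] <;> ring
      map_smul' := fun r v => by
        refine Prod.ext ?_ ?_ <;> simp [killing] <;> ring }

theorem killingCLM_apply (a b c v : ℂ) (p : ℂ × ℝ) :
    killingCLM a b c p v = killing (a * v) (b * v) (c * v) p := rfl

/-- The map `X` has differential `v ↦ killing (s v) (p v) (q v)`, where `!![s, p; q, -s]` is a
nilpotent matrix with holomorphic coefficients. -/
structure IsNullImmersion (U : Set ℂ) (X : ℂ → ℂ × ℝ) (s p q : ℂ → ℂ) : Prop where
  mem : ∀ z ∈ U, 0 < (X z).2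
  diff_s : DifferentiableOn ℂ s U
  diff_p : DifferentiableOn ℂ p U
  diff_q : DifferentiableOn ℂ q U
  nilpotent : ∀ z ∈ U, s z ^ 2 + p z * q z = 0
  hasFDerivAt : ∀ z ∈ U, HasFDerivAt X (killingCLM (s z) (p z) (q z) (X z)) z

/-- Put `Q = c - 2 a ζ - b ζ²` and `σ = a + b ζ`. Nilpotency gives `b Q = -σ²`, which cancels the
terms in `Re (b Q u v)` and `Re (σ² u v)`; what remains is proportional to `Re (conj u * v)`. This
is the conformality of the immersion. -/
theorem hInner_killing (a b c u v : ℂ) {x : ℂ × ℝ} (hx : 0 < x.2) (h : a ^ 2 + b * c = 0) :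
    hInner x (killing (a * u) (b * u) (c * u) x) (killing (a * v) (b * v) (c * v) x) =
      (conj u * v).re * ((normSq (c - 2 * a * x.1 - b * x.1 ^ 2) + normSq b * x.2 ^ 4 +
        2 * x.2 ^ 2 * normSq (a + b * x.1)) / x.2 ^ 2) := by
  have hσ : b * (c - 2 * a * x.1 - b * x.1 ^ 2) = -(a + b * x.1) ^ 2 := by
    linear_combination h
  rw [killing_mul, killing_mul, hInner]
  generalize c - 2 * a * x.1 - b * x.1 ^ 2 = Q at *
  generalize a + b * x.1 = σ at *
  have h1 := congrArg Complex.re hσ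
  have h2 := congrArg Complex.im hσ
  simp [pow_two] at h1 h2
  simp [Complex.normSq_apply, pow_two]
  field_simp
  linear_combination (2 * x.2 ^ 2 * (u.re * v.re - u.im * v.im)) * h1 -
    (2 * x.2 ^ 2 * (u.re * v.im + u.im * v.re)) * h2

/-- The Euclidean cross product of the first two vectors is `(w / 2) Im (conj u * v)` times the
vector multiplied by `r`, where `w = x.2`, so the determinant is, up to explicit factors, the
squared length of that vector. It is the direction of the mean curvature vector in
`IsNullImmersion.meanCurvatureVector_eq`. -/
theorem hVol_killing (a b c u v : ℂ) (r : ℝ) {x : ℂ × ℝ} (hx : 0 < x.2) :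
    hVol x (killing (a * u) (b * u) (c * u) x) (killing (a * v) (b * v) (c * v) x)
      (r • (4 * ((c - 2 * a * x.1 - b * x.1 ^ 2) * conj (a + b * x.1) -
          conj b * (x.2 : ℂ) ^ 2 * (a + b * x.1)),
        2 * (normSq (c - 2 * a * x.1 - b * x.1 ^ 2) - normSq b * x.2 ^ 4) / x.2)) =
      (conj u * v).im * (r * 2 / x.2 ^ 4 *
        ((normSq (c - 2 * a * x.1 - b * x.1 ^ 2) - normSq b * x.2 ^ 4) ^ 2 +
        4 * x.2 ^ 2 * normSq ((c - 2 * a * x.1 - b * x.1 ^ 2) * conj (a + b * x.1) -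
          conj b * (x.2 : ℂ) ^ 2 * (a + b * x.1)))) := by
  rw [killing_mul, killing_mul, hVol, Matrix.det_fin_three]
  generalize c - 2 * a * x.1 - b * x.1 ^ 2 = Q at *
  generalize a + b * x.1 = σ at *
  simp [Complex.normSq_apply, pow_two]
  field_simp
  ring

namespace IsNullImmersion

variable {U : Set ℂ} {X : ℂ → ℂ × ℝ} {s p q : ℂ → ℂ}

theorem fderiv_apply (h : IsNullImmersion U X s p q) {z : ℂ} (hz : z ∈ U) (v : ℂ) :
    fderiv ℝ X z v = killing (s z * v) (p z * v) (q z * v) (X z) := by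
  rw [(h.hasFDerivAt z hz).fderiv, killingCLM_apply]

theorem fderiv_fderiv_apply (h : IsNullImmersion U X s p q) (hU : IsOpen U) {z : ℂ} (hz : z ∈ U)
    (v : ℂ) :
    fderiv ℝ (fun y => fderiv ℝ X y v) z v =
      killing (deriv s z * v ^ 2) (deriv p z * v ^ 2) (deriv q z * v ^ 2) (X z) +
        (-2 * ((s z + p z * (X z).1) * v) * (fderiv ℝ X z v).1 +
            2 * conj (p z * v) * (X z).2 * (fderiv ℝ X z v).2,
          -2 * (fderiv ℝ X z v).2 * ((s z + p z * (X z).1) * v).re -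
            2 * (X z).2 * (p z * v * (fderiv ℝ X z v).1).re) := by
  have hU' := hU.mem_nhds hz
  have e : (fun y => fderiv ℝ X y v) =ᶠ[𝓝 z]
      fun y => killing (s y * v) (p y * v) (q y * v) (X y) := by
    filter_upwards [hU'] with y hy using h.fderiv_apply hy v
  rw [e.fderiv_eq]
  have ds := (h.diff_s.differentiableAt hU').hasDerivAt
  have dp := (h.diff_p.differentiableAt hU').hasDerivAt
  have dq := (h.diff_q.differentiableAt hU').hasDerivAt
  have dX := h.hasFDerivAt z hz
  have hX := dX.differentiableAt
  have hs := ds.differentiableAt.restrictScalars ℝ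
  have hp := dp.differentiableAt.restrictScalars ℝ
  have hq := dq.differentiableAt.restrictScalars ℝ
  have hd : DifferentiableAt ℝ (fun y => killing (s y * v) (p y * v) (q y * v) (X y)) z := by
    have h1 : DifferentiableAt ℝ (fun y => (X y).1) z := hX.fst
    have h2 : DifferentiableAt ℝ (fun y => (X y).2) z := hX.snd
    have h2' : DifferentiableAt ℝ (fun y => ((X y).2 : ℂ)) z :=
      Complex.ofRealCLM.differentiableAt.comp z h2
    have h3 : DifferentiableAt ℝ (fun y => conj (p y * v)) z :=
      conjCLE.differentiableAt.comp z (hp.mul_const v)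
    have h4 : DifferentiableAt ℝ (fun y => (s y * v + p y * v * (X y).1).re) z :=
      reCLM.differentiableAt.comp z ((hs.mul_const v).add ((hp.mul_const v).mul h1))
    unfold killing
    fun_prop
  have hline : HasDerivAt (fun t : ℝ => z + t • v) v 0 := by
    simpa using ((hasDerivAt_id (0 : ℝ)).smul_const v).const_add z
  have hz0 : z + (0 : ℝ) • v = z := by simp
  have ls : HasDerivAt (fun t : ℝ => s (z + t • v)) (deriv s z * v) 0 :=
    (hz0.symm ▸ ds : HasDerivAt s (deriv s z) (z + (0 : ℝ) • v)).comp 0 hline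
  have lp : HasDerivAt (fun t : ℝ => p (z + t • v)) (deriv p z * v) 0 :=
    (hz0.symm ▸ dp : HasDerivAt p (deriv p z) (z + (0 : ℝ) • v)).comp 0 hline
  have lq : HasDerivAt (fun t : ℝ => q (z + t • v)) (deriv q z * v) 0 :=
    (hz0.symm ▸ dq : HasDerivAt q (deriv q z) (z + (0 : ℝ) • v)).comp 0 hline
  have lX : HasDerivAt (fun t : ℝ => X (z + t • v)) (fderiv ℝ X z v) 0 := by
    rw [dX.fderiv]
    exact (hz0.symm ▸ dX : HasFDerivAt X (killingCLM (s z) (p z) (q z) (X z))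
      (z + (0 : ℝ) • v)).comp_hasDerivAt 0 hline
  have l1 : HasDerivAt (fun t : ℝ => (X (z + t • v)).1) (fderiv ℝ X z v).1 0 := lX.fst
  have l2 : HasDerivAt (fun t : ℝ => (X (z + t • v)).2) (fderiv ℝ X z v).2 0 := lX.snd
  rw [← hd.lineDeriv_eq_fderiv]
  refine HasLineDerivAt.lineDeriv ?_
  have lc : HasDerivAt (fun t : ℝ => conj (p (z + t • v) * v)) (conj (deriv p z * v * v)) 0 :=
    conjCLE.toContinuousLinearMap.hasFDerivAt.comp_hasDerivAt 0 (lp.mul_const v)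
  have k1 := ((lq.mul_const v).sub (((ls.mul_const v).const_mul 2).mul l1)).sub
    ((lp.mul_const v).mul (l1.pow 2)) |>.add (lc.mul (l2.ofReal_comp.pow 2))
  have k2 := (l2.const_mul (-2)).mul (reCLM.hasFDerivAt.comp_hasDerivAt 0
    ((ls.mul_const v).add ((lp.mul_const v).mul l1)))
  refine (k1.prodMk k2).congr_deriv ?_
  generalize fderiv ℝ X z v = d
  refine Prod.ext ?_ ?_
  · simp [killing]
    ring
  · simp [killing, pow_two]
    ring

theorem meanCurvatureVector_eq (h : IsNullImmersion U X s p q) (hU : IsOpen U) {z : ℂ}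
    (hz : z ∈ U) :
    meanCurvatureVector X z =
      (1 / (2 * hInner (X z) (fderiv ℝ X z 1) (fderiv ℝ X z 1))) •
        (4 * ((q z - 2 * s z * (X z).1 - p z * (X z).1 ^ 2) * conj (s z + p z * (X z).1) -
          conj (p z) * ((X z).2 : ℂ) ^ 2 * (s z + p z * (X z).1)),
        2 * (normSq (q z - 2 * s z * (X z).1 - p z * (X z).1 ^ 2) -
          normSq (p z) * (X z).2 ^ 4) / (X z).2) := by
  have hw := h.mem z hz
  have hw' : ((X z).2 : ℂ) ≠ 0 := by exact_mod_cast hw.ne'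
  rw [meanCurvatureVector, h.fderiv_fderiv_apply hU hz, h.fderiv_fderiv_apply hU hz]
  congr 1
  -- The derivatives of the holomorphic coefficients enter with the factor `v ^ 2`, and `1 ^ 2 + I ^
  -- 2 = 0`; only first-order terms survive in the trace.
  have e : killing (deriv s z * 1 ^ 2) (deriv p z * 1 ^ 2) (deriv q z * 1 ^ 2) (X z) +
      killing (deriv s z * I ^ 2) (deriv p z * I ^ 2) (deriv q z * I ^ 2) (X z) = 0 := by
    refine Prod.ext ?_ ?_ <;> simp [killing] <;> ring
  rw [h.fderiv_apply hz, h.fderiv_apply hz, killing_mul (s z), killing_mul (s z)]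
  generalize killing (deriv s z * 1 ^ 2) (deriv p z * 1 ^ 2) (deriv q z * 1 ^ 2) (X z) = k1 at *
  generalize killing (deriv s z * I ^ 2) (deriv p z * I ^ 2) (deriv q z * I ^ 2) (X z) = k2 at *
  rw [eq_neg_of_add_eq_zero_right e]
  generalize q z - 2 * s z * (X z).1 - p z * (X z).1 ^ 2 = Q at *
  generalize s z + p z * (X z).1 = σ at *
  refine Prod.ext ?_ ?_
  · apply Complex.ext
    · simp [christoffel, pow_two]
      field_simp
      ring
    · simp [christoffel, pow_two]
      field_simp
      ring
  · simp [christoffel, pow_two, Complex.normSq_apply]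
    field_simp
    ring

end IsNullImmersion

/-! ### A primitive of the flux form of a Killing field -/

/-- A one-form on the half-space whose exterior derivative is the interior product of the volume
form with the Killing field generated by `!![a, b; c, -a]`. -/
def volPrimitive (a b c : ℂ) (p v : ℂ × ℝ) : ℝ :=
  (conj (c - 2 * a * p.1 - b * p.1 ^ 2) * v.1).im / (2 * p.2 ^ 2) + (b * p.1).im * v.2 / p.2

/-- The derivative of `volPrimitive a b c p v` in `p`, in the direction `d`. -/
def volPrimitiveDeriv (a b c : ℂ) (p d v : ℂ × ℝ) : ℝ :=
  (conj ((-2 * a - 2 * b * p.1) * d.1) * v.1).im / (2 * p.2 ^ 2) -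
    (conj (c - 2 * a * p.1 - b * p.1 ^ 2) * v.1).im * d.2 / p.2 ^ 3 +
    (b * d.1).im * v.2 / p.2 - (b * p.1).im * v.2 * d.2 / p.2 ^ 2

/-- The left side is the exterior derivative of the one-form `volPrimitive a b c`, evaluated on the
constant fields `d` and `v`. -/
theorem volPrimitiveDeriv_sub (a b c : ℂ) {p : ℂ × ℝ} (hp : 0 < p.2) (d v : ℂ × ℝ) :
    volPrimitiveDeriv a b c p d v - volPrimitiveDeriv a b c p v d =
      hVol p d v (killing a b c p) := by
  simp only [volPrimitiveDeriv, hVol, killing, Matrix.det_fin_three]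
  simp [pow_two]
  field_simp
  ring

theorem hasDerivAt_volPrimitive (a b c : ℂ) {P V : ℝ → ℂ × ℝ} {d e : ℂ × ℝ} {t : ℝ}
    (hP : HasDerivAt P d t) (hV : HasDerivAt V e t) (hw : 0 < (P t).2) :
    HasDerivAt (fun t => volPrimitive a b c (P t) (V t))
      (volPrimitiveDeriv a b c (P t) d (V t) + volPrimitive a b c (P t) e) t := by
  have p1 : HasDerivAt (fun t => (P t).1) d.1 t := hP.fst
  have p2 : HasDerivAt (fun t => (P t).2) d.2 t := hP.snd
  have v1 : HasDerivAt (fun t => (V t).1) e.1 t := hV.fst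
  have v2 : HasDerivAt (fun t => (V t).2) e.2 t := hV.snd
  have y : HasDerivAt (fun t => conj (c - 2 * a * (P t).1 - b * (P t).1 ^ 2))
      (conj (-(2 * a * d.1) - b * (2 * (P t).1 * d.1))) t := by
    refine conjCLE.toContinuousLinearMap.hasFDerivAt.comp_hasDerivAt t ?_
    exact (((p1.const_mul (2 * a)).const_sub c).sub ((p1.pow 2).const_mul b)).congr_deriv (by simp)
  have k1 := (imCLM.hasFDerivAt.comp_hasDerivAt t (y.mul v1)).div ((p2.pow 2).const_mul 2)
    (by simp [hw.ne'])
  have k2 := ((imCLM.hasFDerivAt.comp_hasDerivAt t (p1.const_mul b)).mul v2).div p2 hw.ne'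
  refine (k1.add k2).congr_deriv ?_
  simp [volPrimitive, volPrimitiveDeriv, pow_two]
  field_simp
  ring

theorem contDiffAt_volPrimitive {E : Type*} [NormedAddCommGroup E] [NormedSpace ℝ E]
    (a b c : ℂ) {P V : E → ℂ × ℝ} {x : E} {n : WithTop ℕ∞}
    (hP : ContDiffAt ℝ n P x) (hV : ContDiffAt ℝ n V x) (hw : 0 < (P x).2) :
    ContDiffAt ℝ n (fun y => volPrimitive a b c (P y) (V y)) x := by
  have p1 : ContDiffAt ℝ n (fun y => (P y).1) x := hP.fst
  have p2 : ContDiffAt ℝ n (fun y => (P y).2) x := hP.snd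
  have v1 : ContDiffAt ℝ n (fun y => (V y).1) x := hV.fst
  have v2 : ContDiffAt ℝ n (fun y => (V y).2) x := hV.snd
  have y : ContDiffAt ℝ n (fun y => c - 2 * a * (P y).1 - b * (P y).1 ^ 2) x := by fun_prop
  have h1 : ContDiffAt ℝ n (fun y => (conj (c - 2 * a * (P y).1 - b * (P y).1 ^ 2) *
      (V y).1).im) x :=
    imCLM.contDiff.contDiffAt.comp x ((conjCLE.contDiff.contDiffAt.comp x y).mul v1)
  have h2 : ContDiffAt ℝ n (fun y => (b * (P y).1).im) x :=
    imCLM.contDiff.contDiffAt.comp x (contDiffAt_const.mul p1)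
  unfold volPrimitive
  exact (h1.div (contDiffAt_const.mul (p2.pow 2)) (by simp [hw.ne'])).add
    ((h2.mul v2).div p2 hw.ne')

/-- Stokes' formula on a disk in polar coordinates. -/
theorem integral_hVol_killing (a b c : ℂ) {K : ℝ × ℝ → ℂ × ℝ} (hK : ContDiff ℝ 2 K)
    (hmem : ∀ r ∈ Icc (0 : ℝ) 1, ∀ t, K (r, t) ∈ halfSpace)
    (hper : ∀ r t, K (r, t + 2 * π) = K (r, t)) (hcenter : ∀ t, K (0, t) = K (0, 0)) :
    (∫ r in (0 : ℝ)..1, ∫ t in (0 : ℝ)..2 * π,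
      hVol (K (r, t)) (fderiv ℝ K (r, t) (1, 0)) (fderiv ℝ K (r, t) (0, 1))
        (killing a b c (K (r, t)))) =
      ∫ t in (0 : ℝ)..2 * π, volPrimitive a b c (K (1, t)) (fderiv ℝ K (1, t) (0, 1)) := by
  have hK' : ContDiff ℝ 1 (fderiv ℝ K) := hK.fderiv_right (by norm_num)
  set F : ℝ × ℝ → ℝ × ℝ → ℝ := fun v x => volPrimitive a b c (K x) (fderiv ℝ K x v) with hF
  have hmem' : ∀ x ∈ uIcc (0 : ℝ) 1 ×ˢ uIcc (0 : ℝ) (2 * π), 0 < (K x).2 := by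
    rintro ⟨r, t⟩ ⟨hr, -⟩
    rw [uIcc_of_le zero_le_one] at hr
    exact hmem r hr t
  have hC : ∀ v, ∀ x ∈ uIcc (0 : ℝ) 1 ×ˢ uIcc (0 : ℝ) (2 * π), ContDiffAt ℝ 1 (F v) x :=
    fun v x hx => contDiffAt_volPrimitive a b c (hK.contDiffAt.of_le (by norm_num))
      (hK'.contDiffAt.clm_apply contDiffAt_const) (hmem' x hx)
  have hD : ∀ u v, ∀ x ∈ uIcc (0 : ℝ) 1 ×ˢ uIcc (0 : ℝ) (2 * π), fderiv ℝ (F v) x u =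
      volPrimitiveDeriv a b c (K x) (fderiv ℝ K x u) (fderiv ℝ K x v) +
        volPrimitive a b c (K x) (fderiv ℝ (fderiv ℝ K) x u v) := by
    intro u v x hx
    rw [← ((hC v x hx).differentiableAt (by norm_num)).lineDeriv_eq_fderiv]
    refine HasLineDerivAt.lineDeriv ?_
    have lP := ((hK.differentiable (by norm_num)) x).hasFDerivAt.hasLineDerivAt u
    have lV := (((hK'.differentiable (by norm_num)) x).hasFDerivAt.hasLineDerivAt u).clm_apply
      (hasDerivAt_const (0 : ℝ) v)
    have := hasDerivAt_volPrimitive a b c lP lV (by simpa using hmem' x hx)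
    simpa [HasLineDerivAt] using this
  -- This is the exterior derivative of the pull-back by `K` of the primitive. The terms containing
  -- second derivatives of `K` cancel by symmetry.
  have hdiv : ∀ x ∈ uIcc (0 : ℝ) 1 ×ˢ uIcc (0 : ℝ) (2 * π),
      fderiv ℝ (F (0, 1)) x (1, 0) + (-fderiv ℝ (F (1, 0)) x) (0, 1) =
        hVol (K x) (fderiv ℝ K x (1, 0)) (fderiv ℝ K x (0, 1)) (killing a b c (K x)) := by
    intro x hx
    have hsymm : IsSymmSndFDerivAt ℝ K x := hK.contDiffAt.isSymmSndFDerivAt (by simp)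
    rw [neg_apply, hD _ _ x hx, hD _ _ x hx, hsymm.eq (1, 0) (0, 1),
      ← volPrimitiveDeriv_sub a b c (hmem' x hx)]
    ring
  have hint : MeasureTheory.IntegrableOn
      (fun x => fderiv ℝ (F (0, 1)) x (1, 0) + (-fderiv ℝ (F (1, 0)) x) (0, 1))
      (uIcc (0 : ℝ) 1 ×ˢ uIcc (0 : ℝ) (2 * π)) := by
    refine ContinuousOn.integrableOn_compact (isCompact_uIcc.prod isCompact_uIcc) fun x hx => ?_
    have hc : ∀ v, ContinuousAt (fderiv ℝ (F v)) x := fun v =>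
      ((hC v x hx).fderiv_right (m := 0) (by norm_num)).continuousAt
    exact (((hc (0, 1)).clm_apply continuousAt_const).add
      ((hc (1, 0)).neg.clm_apply continuousAt_const)).continuousWithinAt
  have hsub : ∀ x ∈ Ioo (min (0 : ℝ) 1) (max 0 1) ×ˢ Ioo (min (0 : ℝ) (2 * π)) (max 0 (2 * π)),
      x ∈ uIcc (0 : ℝ) 1 ×ˢ uIcc (0 : ℝ) (2 * π) := fun x hx =>
    ⟨Ioo_subset_Icc_self hx.1, Ioo_subset_Icc_self hx.2⟩
  have key := MeasureTheory.integral2_divergence_prod_of_hasFDerivAt (F (0, 1)) (-F (1, 0))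
    (fderiv ℝ (F (0, 1))) (-fderiv ℝ (F (1, 0))) 0 0 1 (2 * π)
    (fun x hx => (hC _ x hx).continuousAt.continuousWithinAt)
    (fun x hx => (hC _ x hx).continuousAt.neg.continuousWithinAt)
    (fun x hx => ((hC _ x (hsub x hx)).differentiableAt (by norm_num)).hasFDerivAt)
    (fun x hx => (((hC _ x (hsub x hx)).differentiableAt (by norm_num)).hasFDerivAt).neg) hint
  -- Of the four sides of the rectangle only `r = 1` counts: the sides `t = 0` and `t = 2π` cancel
  -- by periodicity, and on `r = 0` the map `K` is constant.
  have hside : ∀ r, F (1, 0) (r, 2 * π) = F (1, 0) (r, 0) := by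
    intro r
    have e : K = fun x => K (x + (0, 2 * π)) := by
      funext x
      rw [show x + (0, 2 * π) = (x.1, x.2 + 2 * π) by ext <;> simp, hper]
    have e' : fderiv ℝ K (r, 0) = fderiv ℝ K (r, 2 * π) := by
      conv_lhs => rw [e]
      rw [fderiv_comp_add_right]
      simp
    have := hper r 0
    simp only [zero_add] at this
    simp only [hF, e', this]
  have hzero : ∀ t, F (0, 1) (0, t) = 0 := by
    intro t
    have l : HasDerivAt (fun τ : ℝ => ((0 : ℝ), τ)) (0, 1) t :=
      (hasDerivAt_const t 0).prodMk (hasDerivAt_id t)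
    have l' := ((hK.differentiable (by norm_num)) (0, t)).hasFDerivAt.comp_hasDerivAt t l
    have l'' : HasDerivAt (K ∘ fun τ : ℝ => ((0 : ℝ), τ)) 0 t := by
      have : (K ∘ fun τ : ℝ => ((0 : ℝ), τ)) = fun _ => K (0, 0) := funext hcenter
      rw [this]
      exact hasDerivAt_const _ _
    simp [hF, l'.unique l'', volPrimitive]
  have e : (∫ r in (0 : ℝ)..1, ∫ t in (0 : ℝ)..2 * π,
      hVol (K (r, t)) (fderiv ℝ K (r, t) (1, 0)) (fderiv ℝ K (r, t) (0, 1))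
        (killing a b c (K (r, t)))) = ∫ r in (0 : ℝ)..1, ∫ t in (0 : ℝ)..2 * π,
        fderiv ℝ (F (0, 1)) (r, t) (1, 0) + (-fderiv ℝ (F (1, 0))) (r, t) (0, 1) := by
    refine intervalIntegral.integral_congr fun r hr => intervalIntegral.integral_congr fun t ht => ?_
    exact (hdiv (r, t) ⟨hr, ht⟩).symm
  rw [e, key]
  simp only [Pi.neg_apply, hside, hzero]
  simp [hF]

/-! ### The flux as the integral of a holomorphic one-form -/

theorem isOpen_puncturedDisk (R : ℝ) : IsOpen (puncturedDisk R) :=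
  Metric.isOpen_ball.sdiff isClosed_singleton

/-- The flux integrand differs from an exact form by the imaginary part of a holomorphic form. -/
theorem flux_integrand_eq (a b c s p q u : ℂ) {x : ℂ × ℝ} (hx : 0 < x.2) :
    -hInner x (killing (s * (I * u)) (p * (I * u)) (q * (I * u)) x) (killing a b c x) -
        2 * volPrimitive a b c x (killing (s * u) (p * u) (q * u) x) =
      2 * ((2 * a * s + b * q + c * p) * u).im +
        (2 * a.im * ((killing (s * u) (p * u) (q * u) x).2 / x.2) -
          (b * (killing (s * u) (p * u) (q * u) x).1).im) := by
  simp [hInner, volPrimitive, killing, pow_two]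
  field_simp
  ring

/-- By conformality, orthogonality to `dX(u)` forces `v = k i u` with `k` real. The side condition
makes `k` negative and the unit length gives `|dX(u)| = -1 / k`, so the unit conormal times
`|dX(u)|` is `-dX(i u)`. -/
theorem conormal_mul_hNorm {x : ℂ × ℝ} {s p q u v : ℂ} (hx : 0 < x.2) (hn : s ^ 2 + p * q = 0)
    (hunit : hInner x (killing (s * v) (p * v) (q * v) x) (killing (s * v) (p * v) (q * v) x) = 1)
    (horth : hInner x (killing (s * v) (p * v) (q * v) x) (killing (s * u) (p * u) (q * u) x) = 0)
    (hside : (conj u * v).im < 0) (y : ℂ × ℝ) :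
    hInner x (killing (s * v) (p * v) (q * v) x) y *
        hNorm x (killing (s * u) (p * u) (q * u) x) =
      -hInner x (killing (s * (I * u)) (p * (I * u)) (q * (I * u)) x) y := by
  rw [hNorm]
  rw [hInner_killing _ _ _ _ _ hx hn] at hunit horth ⊢
  set m := (normSq (q - 2 * s * x.1 - p * x.1 ^ 2) + normSq p * x.2 ^ 4 +
        2 * x.2 ^ 2 * normSq (s + p * x.1)) / x.2 ^ 2
  have hu : u ≠ 0 := by rintro rfl; simp at hside
  have hu' : 0 < normSq u := normSq_pos.2 hu
  obtain ⟨k, hk⟩ : ∃ k : ℝ, k = (conj u * v).im / normSq u := ⟨_, rfl⟩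
  have hk0 : k < 0 := hk ▸ div_neg_of_neg_of_pos hside hu'
  have hm : m ≠ 0 := by rintro h; simp [h] at hunit
  have hre : (conj u * v).re = 0 := by
    have : (conj v * u).re = 0 := (mul_eq_zero.1 horth).resolve_right hm
    simp at this ⊢
    linarith
  have hv : v = k * (I * u) := by
    have h1 : conj u * v = (k * normSq u : ℝ) * I := by
      apply Complex.ext
      · rw [hre]; simp
      · rw [hk, div_mul_cancel₀ _ hu'.ne']; simp
    have hcu : conj u ≠ 0 := by simpa using hu
    apply mul_left_cancel₀ hcu
    rw [h1, Complex.ofReal_mul, Complex.normSq_eq_conj_mul_self]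
    ring
  have hk2 : (conj u * u).re * m = (1 / -k) ^ 2 := by
    have : (conj v * v).re = k ^ 2 * (conj u * u).re := by
      rw [hv]; simp; ring
    rw [this] at hunit
    rw [div_pow, one_pow, neg_sq, eq_div_iff (pow_ne_zero 2 hk0.ne)]
    linarith
  rw [hk2, Real.sqrt_sq (by rw [one_div_nonneg]; linarith)]
  have e : killing (s * v) (p * v) (q * v) x =
      k • killing (s * (I * u)) (p * (I * u)) (q * (I * u)) x := by
    rw [hv]
    refine Prod.ext ?_ ?_ <;> simp [killing] <;> ring
  rw [e]
  have hk0' := hk0.ne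
  simp [hInner]
  field_simp

namespace IsNullImmersion

variable {U : Set ℂ} {X : ℂ → ℂ × ℝ} {s p q : ℂ → ℂ}

/-- An orthonormal frame with the mean curvature vector as last vector is direct. -/
theorem exists_hVol_eq (h : IsNullImmersion U X s p q) (hU : IsOpen U) {z : ℂ} (hz : z ∈ U) :
    ∃ m : ℝ, 0 ≤ m ∧ ((s z ≠ 0 ∨ p z ≠ 0 ∨ q z ≠ 0) → 0 < m ∧
        0 < hInner (X z) (fderiv ℝ X z 1) (fderiv ℝ X z 1)) ∧
      ∀ u v, hVol (X z) (fderiv ℝ X z u) (fderiv ℝ X z v) (-meanCurvatureVector X z) =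
        -((conj u * v).im * m) := by
  have hw := h.mem z hz
  have hn := h.nilpotent z hz
  rw [h.meanCurvatureVector_eq hU hz, ← neg_smul]
  simp only [h.fderiv_apply hz, hVol_killing _ _ _ _ _ _ hw, hInner_killing _ _ _ _ _ hw hn]
  have hσ : p z * (q z - 2 * s z * (X z).1 - p z * (X z).1 ^ 2) = -(s z + p z * (X z).1) ^ 2 := by
    linear_combination hn
  have hS : (s z ≠ 0 ∨ p z ≠ 0 ∨ q z ≠ 0) → (s z + p z * (X z).1 ≠ 0 ∨ p z ≠ 0 ∨
      q z - 2 * s z * (X z).1 - p z * (X z).1 ^ 2 ≠ 0) := by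
    contrapose!
    rintro ⟨h1, h2, h3⟩
    have h4 : s z = 0 := by simpa [h2] using h1
    simp_all
  generalize q z - 2 * s z * (X z).1 - p z * (X z).1 ^ 2 = Q at *
  generalize s z + p z * (X z).1 = σ at *
  generalize (X z).2 = w at *
  refine ⟨1 / (2 * ((conj (1 : ℂ) * 1).re * ((normSq Q + normSq (p z) * w ^ 4 +
    2 * w ^ 2 * normSq σ) / w ^ 2))) * 2 / w ^ 4 * ((normSq Q - normSq (p z) * w ^ 4) ^ 2 +
      4 * w ^ 2 * normSq (Q * conj σ - conj (p z) * (w : ℂ) ^ 2 * σ)), ?_, ?_, fun u v => ?_⟩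
  · have := normSq_nonneg Q
    have := normSq_nonneg (p z)
    have := normSq_nonneg σ
    have := normSq_nonneg (Q * conj σ - conj (p z) * (w : ℂ) ^ 2 * σ)
    simp
    positivity
  · intro h0
    have hl : 0 < normSq Q + normSq (p z) * w ^ 4 + 2 * w ^ 2 * normSq σ := by
      have h1 := normSq_nonneg Q
      have h2 := normSq_nonneg (p z)
      have h3 := normSq_nonneg σ
      rcases hS h0 with h' | h' | h'
      all_goals have := normSq_pos.2 h'; positivity
    -- The relation `p Q = -σ²` makes the squared length of the direction of the mean curvature
    -- vector equal to the square of the conformal factor times `w ^ 4`, after normalization.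
    -- Geometrically, the mean curvature is one, so the vector does not vanish.
    have hsq : (normSq Q - normSq (p z) * w ^ 4) ^ 2 +
        4 * w ^ 2 * normSq (Q * conj σ - conj (p z) * (w : ℂ) ^ 2 * σ) =
        (normSq Q + normSq (p z) * w ^ 4 + 2 * w ^ 2 * normSq σ) ^ 2 := by
      have h1 : normSq (p z) * normSq Q = normSq σ ^ 2 := by
        rw [← normSq_mul, hσ, normSq_neg, map_pow]
      have h2 : (Q * conj σ * conj (conj (p z) * (w : ℂ) ^ 2 * σ)).re = -(w ^ 2 * normSq σ ^ 2) := by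
        have : Q * conj σ * conj (conj (p z) * (w : ℂ) ^ 2 * σ) =
            ((-(w ^ 2 * normSq σ ^ 2) : ℝ) : ℂ) := by
          push_cast
          rw [← Complex.mul_conj]
          simp
          linear_combination conj σ ^ 2 * (w : ℂ) ^ 2 * hσ
        rw [this, Complex.ofReal_re]
      rw [normSq_sub, h2]
      simp only [normSq_mul, normSq_conj, map_pow, Complex.normSq_ofReal]
      linear_combination -4 * w ^ 4 * h1
    rw [hsq]
    simp
    constructor <;> positivity
  · ring

end IsNullImmersion

theorem continuous_killing {α : Type*} [TopologicalSpace α] {a b c : α → ℂ} {x : α → ℂ × ℝ}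
    (ha : Continuous a) (hb : Continuous b) (hc : Continuous c) (hx : Continuous x) :
    Continuous fun t => killing (a t) (b t) (c t) (x t) := by
  have h1 : Continuous fun t => conj (b t) := Complex.continuous_conj.comp hb
  have h2 : Continuous fun t => (a t + b t * (x t).1).re := Complex.continuous_re.comp (by fun_prop)
  simp only [killing]
  fun_prop

namespace IsNullImmersion

variable {R : ℝ} {X : ℂ → ℂ × ℝ} {s p q : ℂ → ℂ} {γ : ℝ → ℂ} {η : ℝ → ℂ × ℝ}
  {K : ℝ × ℝ → ℂ × ℝ} {ε : ℤ}

theorem hasDerivAt_comp (h : IsNullImmersion (puncturedDisk R) X s p q) {γ' : ℂ} {t : ℝ}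
    (hγ : HasDerivAt γ γ' t) (hmem : γ t ∈ puncturedDisk R) :
    HasDerivAt (X ∘ γ) (killing (s (γ t) * γ') (p (γ t) * γ') (q (γ t) * γ') (X (γ t))) t :=
  (h.hasFDerivAt _ hmem).comp_hasDerivAt t hγ

/-- The orientation by the mean curvature vector makes the curve run clockwise. -/
theorem orientation_eq (h : IsNullImmersion (puncturedDisk R) X s p q)
    (d : IsFluxData R X γ η K ε) : ε = -1 := by
  have hz := d.mem 0
  obtain ⟨m, hm, -, hvol⟩ := h.exists_hVol_eq (isOpen_puncturedDisk R) hz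
  obtain ⟨v, hv, hside⟩ := d.conormal 0
  have ho := d.orientation 0
  have hΓ : deriv (X ∘ γ) 0 = fderiv ℝ X (γ 0) (deriv γ 0) := by
    rw [h.fderiv_apply hz]
    exact (h.hasDerivAt_comp ((d.smooth.differentiable (by norm_num)) 0).hasDerivAt hz).deriv
  rw [hΓ, hv, hvol] at ho
  rcases d.generator with rfl | rfl
  -- An anticlockwise curve has its conormal on the left, so `Im (conj u * v) > 0`; then `(Γ', η,
  -- -H)` has nonpositive volume, against the orientation convention.
  · simp only [Int.cast_one, one_mul] at hside
    linarith [mul_nonneg hside.le hm]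
  · rfl

theorem hInner_conormal (h : IsNullImmersion (puncturedDisk R) X s p q)
    (d : IsFluxData R X γ η K ε) (t : ℝ) (y : ℂ × ℝ) :
    hInner (X (γ t)) (η t) y * hNorm (X (γ t)) (deriv (X ∘ γ) t) =
      -hInner (X (γ t)) (killing (s (γ t) * (I * deriv γ t)) (p (γ t) * (I * deriv γ t))
        (q (γ t) * (I * deriv γ t)) (X (γ t))) y := by
  have hz := d.mem t
  obtain ⟨v, hv, hside⟩ := d.conormal t
  have hu := d.conormal_unit t
  have ho := d.conormal_orth t
  rw [(h.hasDerivAt_comp ((d.smooth.differentiable (by norm_num)) t).hasDerivAt hz).deriv] at ho ⊢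
  rw [hv, h.fderiv_apply hz] at hu ho ⊢
  rw [h.orientation_eq d] at hside
  exact conormal_mul_hNorm (h.mem _ hz) (h.nilpotent _ hz) hu ho
    (by simpa using hside) y

/-- The flux of the Killing field generated by `!![a, b; c, -a]` is the integral of the
imaginary part of a holomorphic one-form. -/
theorem fluxIntegral_eq (h : IsNullImmersion (puncturedDisk R) X s p q)
    (d : IsFluxData R X γ η K ε) {Y : ℂ × ℝ → ℂ × ℝ} {a b c : ℂ}
    (hY : ∀ x, 0 < x.2 → Y x = killing a b c x) :
    fluxIntegral X Y γ η K = 2 * (∫ t in (0 : ℝ)..2 * π,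
      (2 * a * s (γ t) + b * q (γ t) + c * p (γ t)) * deriv γ t).im := by
  have hγ : ∀ t, HasDerivAt γ (deriv γ t) t := fun t =>
    ((d.smooth.differentiable (by norm_num)) t).hasDerivAt
  have cγ : Continuous γ := d.smooth.continuous
  have cγ' : Continuous (deriv γ) := d.smooth.continuous_deriv (by norm_num)
  have cs : Continuous fun t => s (γ t) := h.diff_s.continuousOn.comp_continuous cγ d.mem
  have cp : Continuous fun t => p (γ t) := h.diff_p.continuousOn.comp_continuous cγ d.mem
  have cq : Continuous fun t => q (γ t) := h.diff_q.continuousOn.comp_continuous cγ d.mem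
  set D : ℝ → ℂ × ℝ := fun t =>
    killing (s (γ t) * deriv γ t) (p (γ t) * deriv γ t) (q (γ t) * deriv γ t) (X (γ t)) with hD
  have hΓ : ∀ t, HasDerivAt (X ∘ γ) (D t) t := fun t => h.hasDerivAt_comp (hγ t) (d.mem t)
  have cX : Continuous fun t => X (γ t) :=
    continuous_iff_continuousAt.2 fun t => (hΓ t).continuousAt
  have cX1 : Continuous fun t => (X (γ t)).1 := continuous_fst.comp cX
  have cX2 : Continuous fun t => (X (γ t)).2 := continuous_snd.comp cX
  have cX2' : Continuous fun t => ((X (γ t)).2 : ℂ) := Complex.continuous_ofReal.comp cX2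
  have hpos : ∀ t, 0 < (X (γ t)).2 := fun t => h.mem _ (d.mem t)
  have cD : Continuous D :=
    continuous_killing (cs.mul cγ') (cp.mul cγ') (cq.mul cγ') cX
  have cD1 : Continuous fun t => (D t).1 := continuous_fst.comp cD
  have cD2 : Continuous fun t => (D t).2 := continuous_snd.comp cD
  have cB : Continuous fun t => volPrimitive a b c (X (γ t)) (D t) := by
    have h1 : Continuous fun t => (conj (c - 2 * a * (X (γ t)).1 - b * (X (γ t)).1 ^ 2) *
        (D t).1).im :=
      Complex.continuous_im.comp ((Complex.continuous_conj.comp (by fun_prop)).mul cD1)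
    have h2 : Continuous fun t => (b * (X (γ t)).1).im :=
      Complex.continuous_im.comp (continuous_const.mul cX1)
    unfold volPrimitive
    exact (h1.div (by fun_prop) fun t => by have := hpos t; positivity).add
      ((h2.mul cD2).div cX2 fun t => (hpos t).ne')
  have cC : Continuous fun t =>
      (2 * a * s (γ t) + b * q (γ t) + c * p (γ t)) * deriv γ t :=
    (((continuous_const.mul cs).add (continuous_const.mul cq)).add
      (continuous_const.mul cp)).mul cγ'
  have cE : Continuous fun t => 2 * a.im * ((D t).2 / (X (γ t)).2) - (b * (D t).1).im :=
    (continuous_const.mul (cD2.div cX2 fun t => (hpos t).ne')).sub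
      (Complex.continuous_im.comp (continuous_const.mul cD1))
  -- The exact remainder in `flux_integrand_eq` is the differential of `2 Im a log w - Im (b ζ)`, so
  -- it integrates to zero over the closed curve.
  have hE : ∀ t, HasDerivAt (fun t => 2 * a.im * Real.log (X (γ t)).2 - (b * (X (γ t)).1).im)
      (2 * a.im * ((D t).2 / (X (γ t)).2) - (b * (D t).1).im) t := fun t =>
    (((show HasDerivAt (fun t => (X (γ t)).2) (D t).2 t from (hΓ t).snd).log
      (hpos t).ne').const_mul _).sub (imCLM.hasFDerivAt.comp_hasDerivAt t
        ((show HasDerivAt (fun t => (X (γ t)).1) (D t).1 t from (hΓ t).fst).const_mul b))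
  have iE : ∫ t in (0 : ℝ)..2 * π,
      (2 * a.im * ((D t).2 / (X (γ t)).2) - (b * (D t).1).im) = 0 := by
    rw [intervalIntegral.integral_eq_sub_of_hasDerivAt (fun t _ => hE t)
      (cE.intervalIntegrable _ _)]
    have : γ (2 * π) = γ 0 := by simpa using d.periodic 0
    rw [this, sub_self]
  have hK1 : ∀ t, fderiv ℝ K (1, t) (0, 1) = D t := by
    intro t
    have l : HasDerivAt (fun τ : ℝ => ((1 : ℝ), τ)) (0, 1) t :=
      (hasDerivAt_const t 1).prodMk (hasDerivAt_id t)
    have l' := ((d.disk_smooth.differentiable (by norm_num)) (1, t)).hasFDerivAt.comp_hasDerivAt t l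
    have e : (K ∘ fun τ : ℝ => ((1 : ℝ), τ)) = X ∘ γ := funext d.disk_boundary
    exact l'.unique (e ▸ hΓ t)
  have iK : (∫ r in (0 : ℝ)..1, ∫ t in (0 : ℝ)..2 * π,
      hVol (K (r, t)) (fderiv ℝ K (r, t) (1, 0)) (fderiv ℝ K (r, t) (0, 1)) (Y (K (r, t)))) =
      ∫ t in (0 : ℝ)..2 * π, volPrimitive a b c (X (γ t)) (D t) := by
    rw [← funext hK1]
    simp only [← d.disk_boundary]
    rw [← integral_hVol_killing a b c d.disk_smooth d.disk_mem d.disk_periodic d.disk_center]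
    refine intervalIntegral.integral_congr fun r hr => intervalIntegral.integral_congr fun t _ => ?_
    rw [uIcc_of_le zero_le_one] at hr
    simp only [hY _ (d.disk_mem r hr t)]
  have iA : ∫ t in (0 : ℝ)..2 * π,
      hInner (X (γ t)) (η t) (Y (X (γ t))) * hNorm (X (γ t)) (deriv (X ∘ γ) t) =
      ∫ t in (0 : ℝ)..2 * π,
        ((2 * ((2 * a * s (γ t) + b * q (γ t) + c * p (γ t)) * deriv γ t).im +
        (2 * a.im * ((D t).2 / (X (γ t)).2) - (b * (D t).1).im)) +
          2 * volPrimitive a b c (X (γ t)) (D t)) := by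
    refine intervalIntegral.integral_congr fun t _ => ?_
    simp only [h.hInner_conormal d, hY _ (hpos t)]
    rw [← flux_integrand_eq a b c _ _ _ _ (hpos t)]
    ring
  have iC : (∫ t in (0 : ℝ)..2 * π,
      (2 * a * s (γ t) + b * q (γ t) + c * p (γ t)) * deriv γ t).im =
      ∫ t in (0 : ℝ)..2 * π,
        ((2 * a * s (γ t) + b * q (γ t) + c * p (γ t)) * deriv γ t).im :=
    (imCLM.intervalIntegral_comp_comm (cC.intervalIntegrable _ _)).symm
  have cC' := Complex.continuous_im.comp cC
  rw [fluxIntegral, iA, iK, intervalIntegral.integral_add, intervalIntegral.integral_add, iE,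
    intervalIntegral.integral_const_mul, intervalIntegral.integral_const_mul, iC]
  · ring
  · exact (continuous_const.mul cC').intervalIntegrable _ _
  · exact cE.intervalIntegrable _ _
  · exact ((continuous_const.mul cC').add cE).intervalIntegrable _ _
  · exact (continuous_const.mul cB).intervalIntegrable _ _

end IsNullImmersion

/-! ### Univalent functions and contour integrals -/

/-- If `ψ` vanished to order `n ≥ 2`, then `ψ = g(0) (z k(z))^n` near `0`, where `k` is an `n`-th
root of `g / g(0)` and `z k(z)` is locally invertible. Points where `z k(z)` takes the values `w`
and `ω w`, with `ω` a primitive `n`-th root of unity, would have the same image under `ψ`. -/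
theorem deriv_ne_zero_of_injOn {ψ : ℂ → ℂ} {U : Set ℂ} (hU : U ∈ 𝓝 (0 : ℂ))
    (hψ : AnalyticAt ℂ ψ 0) (hinj : InjOn ψ U) (hψ0 : ψ 0 = 0) : deriv ψ 0 ≠ 0 := by
  have hnz : ¬ ∀ᶠ z in 𝓝 (0 : ℂ), ψ z = 0 := by
    intro h
    have h' : ∀ᶠ z in 𝓝[≠] (0 : ℂ), False := by
      filter_upwards [(h.and hU).filter_mono nhdsWithin_le_nhds, self_mem_nhdsWithin] with z hz hz0
      exact hz0 (hinj hz.2 (mem_of_mem_nhds hU) (hz.1.trans hψ0.symm))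
    exact h'.exists.elim fun _ => id
  obtain ⟨n, g, hg, hg0, hev⟩ := hψ.exists_eventuallyEq_pow_smul_nonzero_iff.2 hnz
  simp only [sub_zero, smul_eq_mul] at hev
  have hn0 : n ≠ 0 := by
    rintro rfl
    have := hev.self_of_nhds
    simp [hψ0] at this
    exact hg0 this.symm
  by_cases hn1 : n = 1
  · subst hn1
    have e : ψ =ᶠ[𝓝 0] fun z => z * g z :=
      hev.mono fun z hz => by simpa using hz
    rw [e.deriv_eq]
    have := (hasDerivAt_id (0 : ℂ)).mul hg.differentiableAt.hasDerivAt
    have h2 := this.deriv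
    simp at h2
    exact (show deriv (fun z => z * g z) 0 = g 0 from h2) ▸ hg0
  exfalso
  set k : ℂ → ℂ := fun z => Complex.exp (Complex.log (g z / g 0) / n) with hk
  have hquot : AnalyticAt ℂ (fun z => g z / g 0) 0 := hg.div analyticAt_const hg0
  have hkan : AnalyticAt ℂ k 0 :=
    ((hquot.clog (by simp [hg0])).div analyticAt_const (by exact_mod_cast hn0)).cexp
  have hk0 : k 0 = 1 := by simp [hk, hg0]
  have hφ : HasStrictDerivAt (fun z => z * k z) 1 0 := by
    have := (analyticAt_id (𝕜 := ℂ) (z := (0 : ℂ))).mul hkan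
    have h1 := this.hasStrictDerivAt
    have h2 := (hasDerivAt_id (0 : ℂ)).mul hkan.differentiableAt.hasDerivAt
    rw [h2.deriv] at h1
    have h3 : HasStrictDerivAt (id * k) 1 0 := by simpa [hk0] using h1
    exact h3
  have hgne : ∀ᶠ z in 𝓝 (0 : ℂ), g z ≠ 0 := hg.continuousAt.eventually_ne hg0
  have hS := (hev.and hgne).and hU
  have hmap := hφ.map_nhds_eq one_ne_zero
  simp only [zero_mul] at hmap
  have hT : (fun z => z * k z) '' {z | ((ψ z = z ^ n * g z) ∧ g z ≠ 0) ∧ z ∈ U} ∈ 𝓝 (0 : ℂ) := by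
    rw [← hmap]
    exact image_mem_map hS
  set ω : ℂ := Complex.exp (2 * π * I / n) with hω
  have hprim : IsPrimitiveRoot ω n := Complex.isPrimitiveRoot_exp n hn0
  have hT' : ∀ᶠ w in 𝓝 (0 : ℂ), ω * w ∈
      (fun z => z * k z) '' {z | ((ψ z = z ^ n * g z) ∧ g z ≠ 0) ∧ z ∈ U} := by
    have hc : Tendsto (fun w => ω * w) (𝓝 0) (𝓝 0) := by
      simpa using (continuous_const_mul ω).tendsto 0
    exact hc hT
  obtain ⟨w, ⟨⟨z₁, ⟨⟨h1, h1g⟩, h1U⟩, rfl⟩, ⟨z₂, ⟨⟨h2, h2g⟩, h2U⟩, hz⟩⟩, hw0⟩ :=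
    (((eventually_mem_set.2 hT).and hT').filter_mono nhdsWithin_le_nhds |>.and
      (self_mem_nhdsWithin : {(0 : ℂ)}ᶜ ∈ 𝓝[≠] (0 : ℂ))).exists
  have hkn : ∀ z, g z ≠ 0 → (z * k z) ^ n * g 0 = z ^ n * g z := by
    intro z hz
    have : k z ^ n = g z / g 0 := by
      rw [hk, ← Complex.exp_nat_mul, mul_div_cancel₀ _ (by exact_mod_cast hn0),
        Complex.exp_log (div_ne_zero hz hg0)]
    rw [mul_pow, this]
    field_simp
  have hz' : z₂ * k z₂ = ω * (z₁ * k z₁) := hz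
  have heq : ψ z₁ = ψ z₂ := by
    rw [h1, h2, ← hkn _ h1g, ← hkn _ h2g, hz', mul_pow ω, hprim.pow_eq_one, one_mul]
  obtain rfl := hinj h1U h2U heq
  exact hprim.ne_one (by omega) (mul_right_cancel₀ hw0 (by rw [one_mul]; exact hz'.symm))

/-- The residue theorem for the pull-back of `E(w) dw / w²` by a univalent function. -/
theorem integral_comp_div_sq {R : ℝ} (hR : 0 < R) {γ : ℝ → ℂ} (hγ : ContDiff ℝ 1 γ)
    (hper : γ (2 * π) = γ 0) (hmem : ∀ t, γ t ∈ puncturedDisk R) {ψ E : ℂ → ℂ}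
    (hψ : DifferentiableOn ℂ ψ (Metric.ball 0 R)) (hinj : InjOn ψ (Metric.ball 0 R))
    (hψ0 : ψ 0 = 0) (hΩ : IsOpen (ψ '' Metric.ball 0 R))
    (hE : DifferentiableOn ℂ E (ψ '' Metric.ball 0 R)) :
    ∫ t in (0 : ℝ)..2 * π, E (ψ (γ t)) / ψ (γ t) ^ 2 * (deriv ψ (γ t) * deriv γ t) =
      deriv E 0 * ∫ t in (0 : ℝ)..2 * π, deriv γ t / γ t := by
  set B := Metric.ball (0 : ℂ) R with hB
  have hB0 : (0 : ℂ) ∈ B := Metric.mem_ball_self hR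
  have hBn : B ∈ 𝓝 (0 : ℂ) := Metric.ball_mem_nhds 0 hR
  have hBo : IsOpen B := Metric.isOpen_ball
  have hψ' := deriv_ne_zero_of_injOn hBn (hψ.analyticAt hBn) hinj hψ0
  have hne : ∀ z ∈ B, z ≠ 0 → ψ z ≠ 0 := fun z hz hz0 h =>
    hz0 (hinj hz hB0 (h.trans hψ0.symm))
  -- Here `ψ = z χ` with `χ` holomorphic and without zeros on the disk, so `dψ / ψ = dz / z + dχ /
  -- χ` and the last term is exact on the disk.
  set χ := dslope ψ 0 with hχ
  have hχd : DifferentiableOn ℂ χ B := (Complex.differentiableOn_dslope hBn).2 hψ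
  have hmul : ∀ z, ψ z = z * χ z := fun z => by
    simpa [hψ0] using (sub_smul_dslope ψ 0 z).symm
  have hχne : ∀ z ∈ B, χ z ≠ 0 := by
    intro z hz
    by_cases h : z = 0
    · rw [h, hχ, dslope_same]; exact hψ'
    · exact fun h' => hne z hz h (by rw [hmul, h', mul_zero])
  have hΩ0 : (0 : ℂ) ∈ ψ '' B := ⟨0, hB0, hψ0⟩
  have hΩn := hΩ.mem_nhds hΩ0
  -- `E2` is the second Taylor quotient: `E(w) = E(0) + E'(0) w + w² E2(w)`.
  set E2 := dslope (dslope E 0) 0 with hE2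
  have hE2d : DifferentiableOn ℂ E2 (ψ '' B) :=
    (Complex.differentiableOn_dslope hΩn).2 ((Complex.differentiableOn_dslope hΩn).2 hE)
  have hEexp : ∀ w, E w = E 0 + deriv E 0 * w + w ^ 2 * E2 w := by
    intro w
    have h1 := sub_smul_dslope E 0 w
    have h2 := sub_smul_dslope (dslope E 0) 0 w
    rw [dslope_same] at h2
    simp only [sub_zero, smul_eq_mul] at h1 h2
    linear_combination -h1 - w * h2
  have hχ'd : DifferentiableOn ℂ (deriv χ) B := hχd.deriv hBo
  have hψ'd : DifferentiableOn ℂ (deriv ψ) B := hψ.deriv hBo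
  have hf : DifferentiableOn ℂ
      (fun z => deriv E 0 * (deriv χ z / χ z) + E2 (ψ z) * deriv ψ z) B :=
    ((hχ'd.div hχd hχne).const_mul _).add
      ((hE2d.comp hψ (mapsTo_image ψ B)).mul hψ'd)
  obtain ⟨H, hH⟩ := hf.isExactOn_ball
  have hlog : ∀ z ∈ B, deriv ψ z = χ z + z * deriv χ z := by
    intro z hz
    have h1 := (hasDerivAt_id z).mul (hχd.differentiableAt (hBo.mem_nhds hz)).hasDerivAt
    have h2 : ψ = id * χ := funext hmul
    rw [h2, h1.deriv]
    simp
  have cγ : Continuous γ := hγ.continuous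
  have cγ' : Continuous (deriv γ) := hγ.continuous_deriv le_rfl
  have hγB : ∀ t, γ t ∈ B := fun t => (hmem t).1
  have hγ0 : ∀ t, γ t ≠ 0 := fun t => (hmem t).2
  have cψ : Continuous fun t => ψ (γ t) := hψ.continuousOn.comp_continuous cγ hγB
  have cψ' : Continuous fun t => deriv ψ (γ t) := hψ'd.continuousOn.comp_continuous cγ hγB
  have cf := hf.continuousOn.comp_continuous cγ hγB
  -- Everything except `E'(0) dz / z` is exact: the double pole has primitive `-E(0) / ψ`, which has
  -- no logarithmic part, and the holomorphic remainder has the primitive `H` on the disk.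
  have hprim : ∀ t, HasDerivAt (fun t => -(E 0 / ψ (γ t)) + H (γ t))
      ((E 0 / ψ (γ t) ^ 2 * deriv ψ (γ t) +
        (deriv E 0 * (deriv χ (γ t) / χ (γ t)) + E2 (ψ (γ t)) * deriv ψ (γ t))) * deriv γ t) t := by
    intro t
    have hz := hγB t
    have hψz := hne _ hz (hγ0 t)
    have dψ := (hψ.differentiableAt (hBo.mem_nhds hz)).hasDerivAt
    have h1 : HasDerivAt (fun z => -(E 0 / ψ z) + H z) _ (γ t) :=
      (((hasDerivAt_const (γ t) (E 0)).div dψ hψz).neg).add (hH _ hz)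
    refine (h1.comp t ((hγ.differentiable (by norm_num)) t).hasDerivAt).congr_deriv ?_
    field_simp
    ring
  have hint : ∀ t, E (ψ (γ t)) / ψ (γ t) ^ 2 * (deriv ψ (γ t) * deriv γ t) =
      deriv E 0 * (deriv γ t / γ t) + (E 0 / ψ (γ t) ^ 2 * deriv ψ (γ t) +
        (deriv E 0 * (deriv χ (γ t) / χ (γ t)) + E2 (ψ (γ t)) * deriv ψ (γ t))) * deriv γ t := by
    intro t
    have hz := hγB t
    have h0 := hγ0 t
    have h1 := hχne _ hz
    rw [hEexp (ψ (γ t))]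
    have h2 : deriv ψ (γ t) / ψ (γ t) = 1 / γ t + deriv χ (γ t) / χ (γ t) := by
      rw [hlog _ hz, hmul]
      field_simp
    have h3 := hne _ hz h0
    have h4 : (E 0 + deriv E 0 * ψ (γ t) + ψ (γ t) ^ 2 * E2 (ψ (γ t))) / ψ (γ t) ^ 2 *
        deriv ψ (γ t) = E 0 / ψ (γ t) ^ 2 * deriv ψ (γ t) +
        deriv E 0 * (deriv ψ (γ t) / ψ (γ t)) + E2 (ψ (γ t)) * deriv ψ (γ t) := by
      field_simp
    rw [← mul_assoc, h4, h2]
    ring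
  have cP : Continuous fun t => (E 0 / ψ (γ t) ^ 2 * deriv ψ (γ t) +
        (deriv E 0 * (deriv χ (γ t) / χ (γ t)) + E2 (ψ (γ t)) * deriv ψ (γ t))) * deriv γ t :=
    (((continuous_const.div (cψ.pow 2) fun t => pow_ne_zero 2 (hne _ (hγB t) (hγ0 t))).mul
      cψ').add cf).mul cγ'
  simp only [hint]
  rw [intervalIntegral.integral_add, intervalIntegral.integral_const_mul,
    intervalIntegral.integral_eq_sub_of_hasDerivAt (fun t _ => hprim t)
      (cP.intervalIntegrable _ _), hper, sub_self, add_zero]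
  · exact (continuous_const.mul (cγ'.div cγ hγ0)).intervalIntegrable _ _
  · exact cP.intervalIntegrable _ _

/-! ### Existence of flux data -/

theorem contDiff_killing {E : Type*} [NormedAddCommGroup E] [NormedSpace ℝ E] {n : WithTop ℕ∞}
    {a b c : E → ℂ} {x : E → ℂ × ℝ} (ha : ContDiff ℝ n a) (hb : ContDiff ℝ n b)
    (hc : ContDiff ℝ n c) (hx : ContDiff ℝ n x) :
    ContDiff ℝ n fun t => killing (a t) (b t) (c t) (x t) := by
  have h1 : ContDiff ℝ n fun t => conj (b t) := conjCLE.contDiff.comp hb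
  have hx1 : ContDiff ℝ n fun t => (x t).1 := hx.fst
  have hx2 : ContDiff ℝ n fun t => (x t).2 := hx.snd
  have hx2' : ContDiff ℝ n fun t => ((x t).2 : ℂ) := Complex.ofRealCLM.contDiff.comp hx2
  have h2 : ContDiff ℝ n fun t => (a t + b t * (x t).1).re :=
    reCLM.contDiff.comp (ha.add (hb.mul hx1))
  simp only [killing]
  fun_prop

namespace IsNullImmersion

variable {R : ℝ} {X : ℂ → ℂ × ℝ} {s p q : ℂ → ℂ}

/-- The curve is a circle run clockwise, with conormal `dX(-k γ)` directed to the puncture. The disk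
is the Euclidean cone over `Γ` with apex `(0, 1)`, which stays in the half-space by convexity. -/
theorem exists_isFluxData (h : IsNullImmersion (puncturedDisk R) X s p q) {ρ : ℝ} (hρ : 0 < ρ)
    (hρR : ρ < R) (hne : ∀ z : ℂ, ‖z‖ = ρ → s z ≠ 0 ∨ p z ≠ 0 ∨ q z ≠ 0) :
    ∃ γ η K ε, IsFluxData R X γ η K ε := by
  set γ : ℝ → ℂ := fun t => ρ * Complex.exp (-(t * I)) with hγdef
  have hγn : ∀ t, ‖γ t‖ = ρ := fun t => by
    simp [hγdef, Complex.norm_exp, abs_of_pos hρ]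
  have hγ0 : ∀ t, γ t ≠ 0 := fun t => by
    rw [← norm_pos_iff, hγn]; exact hρ
  have hmem : ∀ t, γ t ∈ puncturedDisk R := fun t => ⟨by simpa [hγn] using hρR, hγ0 t⟩
  have hcd : ∀ n : WithTop ℕ∞, ContDiff ℝ n γ := fun n => by
    have h1 : ContDiff ℝ n fun t : ℝ => (t : ℂ) := Complex.ofRealCLM.contDiff
    exact contDiff_const.mul ((h1.mul contDiff_const).neg.cexp)
  have hγ' : ∀ t, HasDerivAt γ (-I * γ t) t := fun t => by
    have h1 : HasDerivAt (fun t : ℝ => (t : ℂ)) 1 t := Complex.ofRealCLM.hasDerivAt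
    refine (((h1.mul_const I).neg.cexp).const_mul (ρ : ℂ)).congr_deriv ?_
    simp only [hγdef, Pi.neg_apply]
    ring
  have hder : ∀ t, deriv γ t = -I * γ t := fun t => (hγ' t).deriv
  have hper : Function.Periodic γ (2 * π) := fun t => by
    simp only [hγdef]
    congr 1
    rw [show -(((t + 2 * π : ℝ) : ℂ) * I) = -(t * I) - 2 * π * I by push_cast; ring,
      Complex.exp_periodic.sub_eq]
  have hU := isOpen_puncturedDisk R
  have smooth_comp : ∀ {f : ℂ → ℂ}, DifferentiableOn ℂ f (puncturedDisk R) →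
      ContDiff ℝ 1 fun t => f (γ t) := fun {f} hf => by
    refine contDiff_iff_contDiffAt.2 fun t => ?_
    have h1 : ContDiffAt ℂ 1 f (γ t) := (hf.analyticAt (hU.mem_nhds (hmem t))).contDiffAt
    exact (h1.restrict_scalars ℝ).comp t (hcd 1).contDiffAt
  have hΓ : ∀ t, HasDerivAt (X ∘ γ) (killing (s (γ t) * deriv γ t) (p (γ t) * deriv γ t)
      (q (γ t) * deriv γ t) (X (γ t))) t := fun t =>
    h.hasDerivAt_comp ((hγ' t).differentiableAt.hasDerivAt) (hmem t)
  have hΓd : deriv (X ∘ γ) = fun t => killing (s (γ t) * deriv γ t) (p (γ t) * deriv γ t)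
      (q (γ t) * deriv γ t) ((X ∘ γ) t) := funext fun t => (hΓ t).deriv
  have cγ' : ContDiff ℝ 1 (deriv γ) := by
    rw [show deriv γ = fun t => -I * γ t from funext hder]
    exact contDiff_const.mul (hcd 1)
  have hΓdiff : Differentiable ℝ (X ∘ γ) := fun t => (hΓ t).differentiableAt
  have hΓ1 : ContDiff ℝ 1 (X ∘ γ) := by
    rw [contDiff_one_iff_deriv]
    refine ⟨hΓdiff, ?_⟩
    rw [hΓd]
    exact continuous_killing ((smooth_comp h.diff_s).continuous.mul cγ'.continuous)
      ((smooth_comp h.diff_p).continuous.mul cγ'.continuous)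
      ((smooth_comp h.diff_q).continuous.mul cγ'.continuous) hΓdiff.continuous
  -- Regularity is bootstrapped: the derivative of `X ∘ γ` is a smooth expression in `X ∘ γ` itself
  -- and in functions of class `C¹`.
  have hΓ2 : ContDiff ℝ 2 (X ∘ γ) := by
    rw [show (2 : WithTop ℕ∞) = 1 + 1 by norm_num, contDiff_succ_iff_deriv]
    refine ⟨hΓdiff, by simp, ?_⟩
    rw [hΓd]
    exact contDiff_killing ((smooth_comp h.diff_s).mul cγ') ((smooth_comp h.diff_p).mul cγ')
      ((smooth_comp h.diff_q).mul cγ') hΓ1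
  set m : ℝ → ℝ := fun t => hInner (X (γ t)) (fderiv ℝ X (γ t) (γ t)) (fderiv ℝ X (γ t) (γ t))
    with hm
  have hconf : ∀ t u v, hInner (X (γ t)) (fderiv ℝ X (γ t) u) (fderiv ℝ X (γ t) v) =
      (conj u * v).re * (m t / ρ ^ 2) := fun t u v => by
    simp only [hm, h.fderiv_apply (hmem t),
      hInner_killing _ _ _ _ _ (h.mem _ (hmem t)) (h.nilpotent _ (hmem t))]
    rw [← Complex.normSq_eq_conj_mul_self, Complex.ofReal_re, Complex.normSq_eq_norm_sq (γ t), hγn]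
    field_simp
  have hmpos : ∀ t, 0 < m t := fun t => by
    obtain ⟨_, -, h2, -⟩ := h.exists_hVol_eq hU (hmem t)
    have := (h2 (hne _ (hγn t))).2
    rw [hconf] at this
    simp at this
    exact (div_pos_iff_of_pos_right (by positivity)).1 this
  -- This factor normalizes `dX(γ)` to unit length.
  set k : ℝ → ℝ := fun t => 1 / √(m t) with hk
  have hkpos : ∀ t, 0 < k t := fun t => one_div_pos.2 (Real.sqrt_pos.2 (hmpos t))
  have hkm : ∀ t, k t ^ 2 * m t = 1 := fun t => by
    simp only [hk, div_pow, one_pow, Real.sq_sqrt (hmpos t).le]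
    exact one_div_mul_cancel (hmpos t).ne'
  have hnsq : ∀ t, conj (γ t) * γ t = ((ρ ^ 2 : ℝ) : ℂ) := fun t => by
    rw [← Complex.normSq_eq_conj_mul_self, Complex.normSq_eq_norm_sq, hγn]
  have hside : ∀ t, conj (deriv γ t) * (-(k t) * γ t) = ((-(k t * ρ ^ 2) : ℝ) : ℂ) * I := fun t => by
    rw [hder]
    push_cast
    have := hnsq t
    push_cast at this
    rw [map_mul, map_neg, conj_I]
    linear_combination -I * (k t : ℂ) * this
  have him : ∀ t, (conj (deriv γ t) * (-(k t) * γ t)).im = -(k t * ρ ^ 2) := fun t => by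
    rw [hside, Complex.mul_I_im, Complex.ofReal_re]
  refine ⟨γ, fun t => fderiv ℝ X (γ t) (-(k t) * γ t),
    fun x => ((0 : ℂ), (1 : ℝ)) + x.1 • ((X ∘ γ) x.2 - ((0 : ℂ), (1 : ℝ))), -1, ?_⟩
  refine
    { smooth := hcd 2
      periodic := hper
      regular := fun t => by rw [hder]; exact mul_ne_zero (neg_ne_zero.2 I_ne_zero) (hγ0 t)
      mem := hmem
      generator := Or.inr rfl
      winding := ?_
      conormal := fun t => ⟨_, rfl, ?_⟩
      conormal_unit := fun t => ?_
      conormal_orth := fun t => ?_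
      orientation := fun t => ?_
      disk_smooth := contDiff_const.add (contDiff_fst.smul ((hΓ2.comp contDiff_snd).sub contDiff_const))
      disk_mem := fun r hr t => ?_
      disk_periodic := fun r t => ?_
      disk_center := fun t => ?_
      disk_boundary := fun t => ?_ }
  · have : ∀ t, deriv γ t / γ t = -I := fun t => by rw [hder, mul_div_cancel_right₀ _ (hγ0 t)]
    simp only [this]
    simp
  · rw [him, Int.cast_neg, Int.cast_one, neg_one_mul, neg_neg]
    exact mul_pos (hkpos t) (pow_pos hρ 2)
  · rw [hconf]
    have : conj (-(k t : ℂ) * γ t) * (-(k t) * γ t) = ((k t ^ 2 * ρ ^ 2 : ℝ) : ℂ) := by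
      have := hnsq t
      push_cast at this ⊢
      simp
      linear_combination (k t : ℂ) ^ 2 * this
    rw [this, Complex.ofReal_re, ← hkm t]
    field_simp
  · rw [(hΓ t).deriv, ← h.fderiv_apply (hmem t), hconf]
    have h1 : conj (-(k t : ℂ) * γ t) * deriv γ t = conj (conj (deriv γ t) * (-(k t) * γ t)) := by
      simp [mul_comm]
    rw [h1, hside, Complex.conj_re, Complex.mul_I_re, Complex.ofReal_im, neg_zero, zero_mul]
  · obtain ⟨n, -, h2, h3⟩ := h.exists_hVol_eq hU (hmem t)
    have hn := (h2 (hne _ (hγn t))).1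
    rw [(hΓ t).deriv, ← h.fderiv_apply (hmem t), h3, him, neg_mul, neg_neg]
    exact mul_pos (mul_pos (hkpos t) (pow_pos hρ 2)) hn
  · have hw := h.mem _ (hmem t)
    simp only [halfSpace, mem_ofPred_eq, Function.comp_apply, Prod.snd_add, Prod.smul_snd,
      Prod.snd_sub, smul_eq_mul]
    rcases hr.2.eq_or_lt with h1 | h1
    · rw [h1]; linarith
    · nlinarith [mul_nonneg hr.1 hw.le]
  · simp [hper t]
  · simp
  · simp

end IsNullImmersion

/-! ### Reduction of indirect isometries to direct ones -/

theorem reflectIf_true_apply (p : ℂ × ℝ) : reflectIf true p = (conj p.1, p.2) := rfl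

theorem toHerm_reflectIf (p : ℂ × ℝ) : toHerm (reflectIf true p) = (toHerm p).map conj := by
  ext i j
  fin_cases i <;> fin_cases j <;> simp [toHerm, reflectIf_true_apply]

theorem ofHerm_map_conj (N : Matrix (Fin 2) (Fin 2) ℂ) :
    ofHerm (N.map conj) = reflectIf true (ofHerm N) := by
  simp [ofHerm, reflectIf_true_apply]

theorem map_conj_mul_conjTranspose (N : Matrix (Fin 2) (Fin 2) ℂ) :
    N.map conj * (N.map conj)ᴴ = (N * Nᴴ).map conj := by
  rw [Matrix.map_mul]
  congr 1

/-- This moves the reflection past a direct isometry: `act P` after the reflection equals the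
reflection after `act (P.map conj)`. The reflection can then be absorbed in the canonical end. -/
theorem act_map_conj (P : Matrix (Fin 2) (Fin 2) ℂ) (p : ℂ × ℝ) :
    act (P.map conj) p = reflectIf true (act P (reflectIf true p)) := by
  rw [act, act, ← ofHerm_map_conj, toHerm_reflectIf, Matrix.map_mul, Matrix.map_mul]
  congr 2
  · congr 1
    ext i j
    simp

/-- In homogeneous coordinates the boundary condition becomes one linear equation on the second row
of `P`, with no separate case for `∞`. The analogous equation at `B` concerns the first row. -/
theorem homog_of_actBoundary_eq_zero {P : Matrix (Fin 2) (Fin 2) ℂ} {A : OnePoint ℂ}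
    (h : actBoundary P A = ((0 : ℂ) : OnePoint ℂ)) :
    P 1 1 * (homog A).1 + P 1 0 * (homog A).2 = 0 := by
  induction A using OnePoint.rec with
  | infty =>
    simp only [actBoundary] at h
    split_ifs at h with h0
    · exact absurd h (OnePoint.infty_ne_coe _)
    · simpa [homog, h0] using OnePoint.coe_injective h
  | coe z =>
    simp only [actBoundary] at h
    split_ifs at h with h0
    · exact absurd h (OnePoint.infty_ne_coe _)
    · simpa [homog, h0] using OnePoint.coe_injective h

theorem homog_of_actBoundary_eq_infty {P : Matrix (Fin 2) (Fin 2) ℂ} {B : OnePoint ℂ}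
    (h : actBoundary P B = ∞) : P 0 1 * (homog B).1 + P 0 0 * (homog B).2 = 0 := by
  induction B using OnePoint.rec with
  | infty =>
    simp only [actBoundary] at h
    split_ifs at h with h0
    · simpa [homog] using h0
    · exact absurd h (OnePoint.coe_ne_infty _)
  | coe z =>
    simp only [actBoundary] at h
    split_ifs at h with h0
    · simpa [homog] using h0
    · exact absurd h (OnePoint.coe_ne_infty _)

theorem homog_map_conj (A : OnePoint ℂ) :
    homog (A.map (conjIf true)) = (conj (homog A).1, conj (homog A).2) := by
  induction A using OnePoint.rec <;> simp [homog, conjIf]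

theorem conjIf_false : conjIf false = id := rfl

theorem canonicalBryantRep_conj (μ : ℝ) (f₁ f₂ g₁ g₂ : ℂ → ℂ) (u : ℂ) :
    canonicalBryantRep μ (conj ∘ f₁ ∘ conj) (conj ∘ f₂ ∘ conj) (conj ∘ g₁ ∘ conj)
      (conj ∘ g₂ ∘ conj) u = (canonicalBryantRep μ f₁ f₂ g₁ g₂ (conj u)).map conj := by
  ext i j
  fin_cases i <;> fin_cases j <;>
    simp [canonicalBryantRep, ← Complex.exp_conj, Complex.conj_ofNat]

theorem weierstrassForm_conj (μ : ℝ) (h : ℂ → ℂ) (u : ℂ) :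
    weierstrassForm μ (conj ∘ h ∘ conj) u = (weierstrassForm μ h (conj u)).map conj := by
  ext i j
  fin_cases i <;> fin_cases j <;> simp [weierstrassForm, ← Complex.exp_conj]

/-- All the constants and exponents in the canonical form are real, so replacing each function `f`
by `conj ∘ f ∘ conj` keeps the form and reflects the end. -/
theorem IsCanonicalCatenoidalEnd.conj {μ : ℝ} {Ω : Set ℂ} {X : ℂ → ℂ × ℝ}
    (h : IsCanonicalCatenoidalEnd μ 0 Ω X) :
    IsCanonicalCatenoidalEnd μ 0 ((starRingEnd ℂ) ⁻¹' Ω)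
      (fun z => reflectIf true (X ((starRingEnd ℂ) z))) := by
  obtain ⟨ho, h0, f₁, f₂, g₁, g₂, k, ⟨d1, d2, d3, d4, d5⟩, ⟨e1, e2, e3, e4, e5⟩, hZ, hF⟩ := h
  have hd : ∀ {f : ℂ → ℂ}, DifferentiableOn ℂ f Ω →
      DifferentiableOn ℂ (starRingEnd ℂ ∘ f ∘ starRingEnd ℂ) ((starRingEnd ℂ) ⁻¹' Ω) := by
    intro f hf z hz
    exact (differentiableAt_conj_conj_iff.2
      (hf.differentiableAt (ho.mem_nhds hz))).differentiableWithinAt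
  refine ⟨ho.preimage Complex.continuous_conj, by simpa using h0, _, _, _, _, _,
    ⟨hd d1, hd d2, hd d3, hd d4, hd d5⟩, ⟨by simp [e1], by simp [e2], by simp [e3], by simp [e4],
      fun z hz => ?_⟩, ?_, fun u hu => ?_⟩
  · simpa using e5 _ hz
  · rw [deriv_conj_conj]
    rcases mul_eq_zero.1 hZ.symm with h | h
    · simp [h]
    · simp [h]
  · have hu' : Complex.exp ((starRingEnd ℂ) u) ∈ Ω := by rw [Complex.exp_conj]; exact hu
    obtain ⟨hdet, hder, hX⟩ := hF _ hu'
    refine ⟨?_, fun i j => ?_, ?_⟩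
    · rw [canonicalBryantRep_conj, ← RingHom.mapMatrix_apply, ← RingHom.map_det, hdet, map_one]
    · have := hasDerivAt_conj_conj_iff.2 (by simpa using hder i j :
        HasDerivAt (fun v => canonicalBryantRep μ f₁ f₂ g₁ g₂ v i j)
          ((starRingEnd ℂ) ((starRingEnd ℂ) ((canonicalBryantRep μ f₁ f₂ g₁ g₂ ((starRingEnd ℂ) u) *
            weierstrassForm μ k ((starRingEnd ℂ) u)) i j))) ((starRingEnd ℂ) u))
      simp only [canonicalBryantRep_conj, weierstrassForm_conj, ← Matrix.map_mul]
      exact this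
    · simp only [canonicalBryantRep_conj, map_conj_mul_conjTranspose, ofHerm_map_conj,
        ← Complex.exp_conj, hX]

/-- A catenoidal end is the image of a canonical one by a direct isometry. -/
theorem IsCatenoidalEnd.exists_direct {μ : ℝ} {A B : OnePoint ℂ} {R : ℝ} {X : ℂ → ℂ × ℝ}
    (h : IsCatenoidalEnd μ A B R X) :
    ∃ (P : Matrix (Fin 2) (Fin 2) ℂ) (ψ : ℂ → ℂ) (X₀ : ℂ → ℂ × ℝ), P.det = 1 ∧
      P 1 1 * (homog A).1 + P 1 0 * (homog A).2 = 0 ∧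
      P 0 1 * (homog B).1 + P 0 0 * (homog B).2 = 0 ∧
      ψ 0 = 0 ∧ InjOn ψ (Metric.ball 0 R) ∧ DifferentiableOn ℂ ψ (Metric.ball 0 R) ∧
      IsCanonicalCatenoidalEnd μ 0 (ψ '' Metric.ball 0 R) X₀ ∧
      ∀ z ∈ puncturedDisk R, act P (X z) = X₀ (ψ z) := by
  obtain ⟨-, -, P, s, ψ, X₀, hP, hA, hB, hψ0, hinj, hψ, hX₀, hX⟩ := h
  have hA := homog_of_actBoundary_eq_zero hA
  have hB := homog_of_actBoundary_eq_infty hB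
  cases s with
  | false =>
    rw [conjIf_false, OnePoint.map_id] at hA hB
    exact ⟨P, ψ, X₀, hP, hA, hB, hψ0, hinj, hψ, hX₀, hX⟩
  | true =>
    rw [homog_map_conj] at hA hB
    refine ⟨P.map conj, fun z => conj (ψ z), fun z => reflectIf true (X₀ (conj z)), ?_, ?_, ?_,
      by simp [hψ0], fun x hx y hy hxy => hinj hx hy (by simpa using congrArg conj hxy), hψ, ?_,
      fun z hz => ?_⟩
    · rw [← RingHom.mapMatrix_apply, ← RingHom.map_det, hP, map_one]
    · simpa using congrArg conj hA
    · simpa using congrArg conj hB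
    · convert hX₀.conj using 1
      ext z
      constructor
      · rintro ⟨x, hx, rfl⟩
        exact ⟨x, hx, by simp⟩
      · rintro ⟨x, hx, hz⟩
        exact ⟨x, hx, by simp [hz]⟩
    · rw [act_map_conj, hX z hz]
      simp

/-! ### The logarithmic derivative of a canonical Bryant representation -/

/-- The matrix `F' F⁻¹ = !![a, w b; c / w, -a]` of a canonical Bryant representation is a
single-valued nilpotent function of `w = exp u`, with an explicit residue at the puncture. -/
theorem IsCanonicalCatenoidalEnd.exists_logDeriv {μ : ℝ} (hμ : 0 < μ) (hμ1 : μ ≠ 1) {Ω : Set ℂ}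
    {X : ℂ → ℂ × ℝ} (hX : IsCanonicalCatenoidalEnd μ 0 Ω X) :
    ∃ (a b c : ℂ → ℂ) (F : ℂ → Matrix (Fin 2) (Fin 2) ℂ), DifferentiableOn ℂ a Ω ∧
      DifferentiableOn ℂ b Ω ∧ DifferentiableOn ℂ c Ω ∧
      a 0 = (1 - (μ : ℂ) ^ 2) / 4 ∧ deriv c 0 = 0 ∧
      ∀ u, Complex.exp u ∈ Ω →
        a (Complex.exp u) ^ 2 + b (Complex.exp u) * c (Complex.exp u) = 0 ∧
        (a (Complex.exp u) ≠ 0 ∨ b (Complex.exp u) ≠ 0 ∨ c (Complex.exp u) ≠ 0) ∧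
        (F u).det = 1 ∧ X (Complex.exp u) = ofHerm (F u * (F u)ᴴ) ∧
        ∀ i j, HasDerivAt (fun v => F v i j)
          ((!![a (Complex.exp u), Complex.exp u * b (Complex.exp u);
            c (Complex.exp u) / Complex.exp u, -a (Complex.exp u)] * F u) i j) u := by
  obtain ⟨ho, h0, f₁, f₂, g₁, g₂, h, ⟨d1, d2, d3, d4, -⟩, ⟨e1, e2, e3, e4, e5⟩, hZ, hF⟩ := hX
  set α : ℂ := (1 - μ) / 2 with hα
  set β : ℂ := (1 + μ) / 2 with hβ
  set k : ℂ := (μ - 1) / (μ + 1) with hk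
  set m : ℂ := (μ ^ 2 - 1) / (4 * μ) with hm
  set n : ℂ := (1 + μ) ^ 2 / (4 * μ) with hn
  have hμ0 : (μ : ℂ) ≠ 0 := by exact_mod_cast hμ.ne'
  have hμp : (μ : ℂ) + 1 ≠ 0 := by exact_mod_cast (by positivity : μ + 1 ≠ 0)
  have hμm : (μ : ℂ) - 1 ≠ 0 := by exact_mod_cast sub_ne_zero.2 hμ1
  have hm0 : m ≠ 0 := by
    rw [hm, show (μ : ℂ) ^ 2 - 1 = (μ - 1) * (μ + 1) by ring]
    exact div_ne_zero (mul_ne_zero hμm hμp) (mul_ne_zero (by norm_num) hμ0)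
  have hn0 : n ≠ 0 := by
    rw [hn, add_comm]
    exact div_ne_zero (pow_ne_zero 2 hμp) (mul_ne_zero (by norm_num) hμ0)
  have hΩn := ho.mem_nhds h0
  have hf₁ : deriv f₁ 0 = 0 := by
    simpa [hm0] using hZ.symm
  set F := canonicalBryantRep μ f₁ f₂ g₁ g₂ with hFdef
  have hder : ∀ {f : ℂ → ℂ}, DifferentiableOn ℂ f Ω → ∀ (r t u : ℂ), Complex.exp u ∈ Ω →
      HasDerivAt (fun v => r * Complex.exp (t * v) * f (Complex.exp v))
        (r * Complex.exp (t * u) * (t * f (Complex.exp u) +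
          Complex.exp u * deriv f (Complex.exp u))) u := by
    intro f hf r t u hu
    have h1 : HasDerivAt (fun v : ℂ => Complex.exp (t * v)) (Complex.exp (t * u) * (t * 1)) u :=
      ((hasDerivAt_id u).const_mul t).cexp
    have h2 := (hf.differentiableAt (ho.mem_nhds hu)).hasDerivAt.comp u (Complex.hasDerivAt_exp u)
    refine ((h1.const_mul r).mul h2).congr_deriv ?_
    simp only [Function.comp_apply]
    ring
  have E00 : ∀ u, F u 0 0 = 1 * Complex.exp (α * u) * f₂ (Complex.exp u) := fun u => by
    simp [hFdef, canonicalBryantRep, hα]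
  have E01 : ∀ u, F u 0 1 = k * Complex.exp (β * u) * g₂ (Complex.exp u) := fun u => by
    simp [hFdef, canonicalBryantRep, hβ, hk]
  have E10 : ∀ u, F u 1 0 = m * Complex.exp (-β * u) * f₁ (Complex.exp u) := fun u => by
    rw [show -β * u = (-1 - μ) / 2 * u by rw [hβ]; ring]
    simp [hFdef, canonicalBryantRep, hm]
  have E11 : ∀ u, F u 1 1 = n * Complex.exp (-α * u) * g₁ (Complex.exp u) := fun u => by
    rw [show -α * u = (μ - 1) / 2 * u by rw [hα]; ring]
    simp [hFdef, canonicalBryantRep, hn]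
  have D00 : ∀ u, Complex.exp u ∈ Ω → HasDerivAt (fun v => F v 0 0) (1 * Complex.exp (α * u) *
      (α * f₂ (Complex.exp u) + Complex.exp u * deriv f₂ (Complex.exp u))) u := fun u hu => by
    simpa only [E00] using hder d2 1 α u hu
  have D01 : ∀ u, Complex.exp u ∈ Ω → HasDerivAt (fun v => F v 0 1) (k * Complex.exp (β * u) *
      (β * g₂ (Complex.exp u) + Complex.exp u * deriv g₂ (Complex.exp u))) u := fun u hu => by
    simpa only [E01] using hder d4 k β u hu
  have D10 : ∀ u, Complex.exp u ∈ Ω → HasDerivAt (fun v => F v 1 0) (m * Complex.exp (-β * u) *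
      (-β * f₁ (Complex.exp u) + Complex.exp u * deriv f₁ (Complex.exp u))) u := fun u hu => by
    simpa only [E10] using hder d1 m (-β) u hu
  have D11 : ∀ u, Complex.exp u ∈ Ω → HasDerivAt (fun v => F v 1 1) (n * Complex.exp (-α * u) *
      (-α * g₁ (Complex.exp u) + Complex.exp u * deriv g₁ (Complex.exp u))) u := fun u hu => by
    simpa only [E11] using hder d3 n (-α) u hu
  -- the two expressions of the derivative of `F`
  have W00 := fun u hu => ((hF u hu).2.1 0 0).unique (D00 u hu)
  have W01 := fun u hu => ((hF u hu).2.1 0 1).unique (D01 u hu)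
  have W10 := fun u hu => ((hF u hu).2.1 1 0).unique (D10 u hu)
  have W11 := fun u hu => ((hF u hu).2.1 1 1).unique (D11 u hu)
  simp only [Matrix.mul_apply, Fin.sum_univ_two, weierstrassForm, Matrix.smul_apply,
    Matrix.of_apply, Matrix.cons_val', Matrix.cons_val_zero, Matrix.cons_val_one,
    Matrix.cons_val_fin_one, smul_eq_mul] at W00 W01 W10 W11
  -- The second column of `weierstrassForm` is `-g` times the first, so `F₁₁' = -g F₁₀'`. Since `-α
  -- = μ - β`, dividing out the exponentials leaves a holomorphic identity between `g₁` and `f₁`.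
  -- Differentiating it at `0` gives `n (1 - α) g₁'(0) = 0`, where `1 - α = (μ + 1) / 2`.
  have hg₁ : deriv g₁ 0 = 0 := by
    have hev : (fun w => n * (-α * g₁ w + w * deriv g₁ w)) =ᶠ[𝓝 0]
        fun w => -(m * (-β * f₁ w + w * deriv f₁ w)) := by
      filter_upwards [hΩn] with w hw
      by_cases hw0 : w = 0
      · rw [hw0, e1, e3, hn, hm, hα, hβ]
        field_simp
        ring
      · have hexp := Complex.exp_log hw0
        generalize Complex.log w = u at hexp
        subst hexp
        have h10 := W10 u hw
        have h11 := W11 u hw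
        have e : Complex.exp (-α * u) = Complex.exp (μ * u) * Complex.exp (-β * u) := by
          rw [← Complex.exp_add]
          congr 1
          rw [hα, hβ]
          ring
        rw [e] at h11
        apply mul_left_cancel₀ (mul_ne_zero (Complex.exp_ne_zero (μ * u))
          (Complex.exp_ne_zero (-β * u)))
        linear_combination -h11 - Complex.exp (μ * u) * h10
    have dd : ∀ {f : ℂ → ℂ}, DifferentiableOn ℂ f Ω → ∀ r t : ℂ,
        HasDerivAt (fun w => r * (t * f w + w * deriv f w)) (r * (t + 1) * deriv f 0) 0 := by
      intro f hf r t
      have h1 := (hf.differentiableAt hΩn).hasDerivAt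
      have h2 := ((hf.deriv ho).differentiableAt hΩn).hasDerivAt
      refine (((h1.const_mul t).add ((hasDerivAt_id (0 : ℂ)).mul h2)).const_mul r).congr_deriv ?_
      simp
      ring
    have := ((dd d3 n (-α)).congr_of_eventuallyEq hev.symm).unique (dd d1 m (-β)).neg
    rw [hf₁, mul_zero, neg_zero] at this
    refine (mul_eq_zero.1 this).resolve_left (mul_ne_zero hn0 ?_)
    rw [hα, show -((1 - (μ : ℂ)) / 2) + 1 = (μ + 1) / 2 by ring]
    exact div_ne_zero hμp two_ne_zero
  have ddf : ∀ {f : ℂ → ℂ}, DifferentiableOn ℂ f Ω → ∀ t : ℂ,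
      DifferentiableOn ℂ (fun w => t * f w + w * deriv f w) Ω := fun hf t =>
    (hf.const_mul t).add (differentiableOn_id.mul (hf.deriv ho))
  -- These are the entries of `F' F⁻¹` after division by powers of `w`. The exponents cancel on the
  -- diagonal, and `α + β = 1` leaves exactly `w` and `1 / w` off it.
  refine ⟨fun w => n * ((α * f₂ w + w * deriv f₂ w) * g₁ w) -
      k * m * ((β * g₂ w + w * deriv g₂ w) * f₁ w),
    fun w => k * ((β * g₂ w + w * deriv g₂ w) * f₂ w - (α * f₂ w + w * deriv f₂ w) * g₂ w),
    fun w => m * n * ((-β * f₁ w + w * deriv f₁ w) * g₁ w -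
      (-α * g₁ w + w * deriv g₁ w) * f₁ w), F,
    (((ddf d2 α).mul d3).const_mul n).sub (((ddf d4 β).mul d1).const_mul (k * m)),
    (((ddf d4 β).mul d2).sub ((ddf d2 α).mul d4)).const_mul k,
    (((ddf d1 (-β)).mul d3).sub ((ddf d3 (-α)).mul d1)).const_mul (m * n), ?_, ?_,
    fun u hu => ?_⟩
  · simp only [e1, e2, e3, e4, zero_mul, add_zero, mul_one, hn, hk, hm, hα, hβ]
    field_simp
    ring
  -- The entry `c / w` contributes a term `c(w) dw / w²`, whose residue is `c'(0)`; it vanishes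
  -- because both `f₁` and `g₁` have zero derivative at `0`.
  · have h1 := (d1.differentiableAt hΩn).hasDerivAt
    have h2 := (d3.differentiableAt hΩn).hasDerivAt
    have h1' := ((d1.deriv ho).differentiableAt hΩn).hasDerivAt
    have h2' := ((d3.deriv ho).differentiableAt hΩn).hasDerivAt
    have l1 := ((h1.const_mul (-β)).add ((hasDerivAt_id (0 : ℂ)).mul h1')).mul h2
    have l2 := ((h2.const_mul (-α)).add ((hasDerivAt_id (0 : ℂ)).mul h2')).mul h1
    have := ((l1.sub l2).const_mul (m * n)).deriv
    refine Eq.trans this ?_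
    simp [hf₁, hg₁]
  · have hw0 := Complex.exp_ne_zero u
    obtain ⟨hdet, hderiv, hX⟩ := hF u hu
    rw [Matrix.det_fin_two] at hdet
    have xα : Complex.exp (α * u) * Complex.exp (-α * u) = 1 := by
      rw [← Complex.exp_add]; simp
    have xβ : Complex.exp (β * u) * Complex.exp (-β * u) = 1 := by
      rw [← Complex.exp_add]; simp
    have xαβ : Complex.exp (α * u) * Complex.exp (β * u) = Complex.exp u := by
      rw [← Complex.exp_add]
      congr 1
      rw [hα, hβ]
      ring
    have xαβ' : Complex.exp u * (Complex.exp (-α * u) * Complex.exp (-β * u)) = 1 := by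
      rw [← Complex.exp_add, ← Complex.exp_add, ← Complex.exp_zero]
      congr 1
      rw [hα, hβ]
      ring
    have w00 := W00 u hu
    have w01 := W01 u hu
    have w10 := W10 u hu
    have w11 := W11 u hu
    have hω : Complex.exp (-μ * u) * h (Complex.exp u) ≠ 0 :=
      mul_ne_zero (Complex.exp_ne_zero _) (e5 _ hu)
    have dF : ∀ i j, HasDerivAt (fun v => F v i j)
        ((!![1 * Complex.exp (α * u) * (α * f₂ (Complex.exp u) + Complex.exp u * deriv f₂ (Complex.exp u)),
          k * Complex.exp (β * u) * (β * g₂ (Complex.exp u) + Complex.exp u * deriv g₂ (Complex.exp u));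
          m * Complex.exp (-β * u) * (-β * f₁ (Complex.exp u) + Complex.exp u * deriv f₁ (Complex.exp u)),
          n * Complex.exp (-α * u) * (-α * g₁ (Complex.exp u) + Complex.exp u * deriv g₁ (Complex.exp u))] :
            Matrix (Fin 2) (Fin 2) ℂ) i j) u := by
      intro i j
      fin_cases i <;> fin_cases j
      exacts [D00 u hu, D01 u hu, D10 u hu, D11 u hu]
    have x00 := E00 u
    have x01 := E01 u
    have x10 := E10 u
    have x11 := E11 u
    simp only []
    generalize Complex.exp u = w at *
    generalize f₁ w = F₁ at *
    generalize f₂ w = F₂ at *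
    generalize g₁ w = G₁ at *
    generalize g₂ w = G₂ at *
    generalize -β * F₁ + w * deriv f₁ w = p₁ at *
    generalize α * F₂ + w * deriv f₂ w = p₂ at *
    generalize -α * G₁ + w * deriv g₁ w = q₁ at *
    generalize β * G₂ + w * deriv g₂ w = q₂ at *
    have ha : n * (p₂ * G₁) - k * m * (q₂ * F₁) =
        1 * Complex.exp (α * u) * p₂ * F u 1 1 - k * Complex.exp (β * u) * q₂ * F u 1 0 := by
      rw [x11, x10]
      linear_combination -(n * p₂ * G₁) * xα + k * m * q₂ * F₁ * xβ
    have hb : w * (k * (q₂ * F₂ - p₂ * G₂)) =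
        k * Complex.exp (β * u) * q₂ * F u 0 0 - 1 * Complex.exp (α * u) * p₂ * F u 0 1 := by
      rw [x00, x01]
      linear_combination -(k * (q₂ * F₂ - p₂ * G₂)) * xαβ
    have hc : m * n * (p₁ * G₁ - q₁ * F₁) / w =
        m * Complex.exp (-β * u) * p₁ * F u 1 1 - n * Complex.exp (-α * u) * q₁ * F u 1 0 := by
      rw [x11, x10, div_eq_iff hw0]
      linear_combination -(m * n * (p₁ * G₁ - q₁ * F₁)) * xαβ'
    generalize n * (p₂ * G₁) - k * m * (q₂ * F₁) = a at *
    generalize k * (q₂ * F₂ - p₂ * G₂) = b at *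
    generalize m * n * (p₁ * G₁ - q₁ * F₁) = c at *
    rw [← w00, ← w01, ← w10, ← w11] at dF
    rw [← w00, ← w01] at ha hb
    rw [← w10, ← w11] at hc
    clear w00 w01 w10 w11 x00 x01 x10 x11 W00 W01 W10 W11 E00 E01 E10 E11 D00 D01 D10 D11 hF hFdef
    generalize Complex.exp (-μ * u) * h w = ω at *
    generalize Complex.exp (μ * u) = g at *
    -- The matrix of `weierstrassForm` is `ω` times the column `(g, 1)` times the row `(1, -g)`.
    -- Hence `F' F⁻¹` is `ω` times the column `F (g, 1)` times the row `(1, -g) F⁻¹`, which shows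
    -- nilpotency.
    have ha' : a = ω * (F u 0 0 * g + F u 0 1) * (F u 1 1 + g * F u 1 0) := by
      rw [ha]; ring
    have hb' : w * b = -ω * (F u 0 0 * g + F u 0 1) ^ 2 := by
      rw [hb]; ring
    have hc' : c / w = ω * (F u 1 0 * g + F u 1 1) ^ 2 := by
      rw [hc]; ring
    refine ⟨?_, ?_, ?_, hX, fun i j => (dF i j).congr_deriv ?_⟩
    · have : b * c = (w * b) * (c / w) := by field_simp
      rw [this, ha', hb', hc']
      ring
    -- If both off-diagonal entries vanish, then `F` kills the nonzero vector `(g, 1)`,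
    -- contradicting `det F = 1`.
    · by_contra! hcon
      obtain ⟨-, rfl, rfl⟩ := hcon
      rw [mul_zero, eq_comm, neg_mul, neg_eq_zero, mul_eq_zero, or_iff_right hω,
        pow_eq_zero_iff two_ne_zero] at hb'
      rw [zero_div, eq_comm, mul_eq_zero, or_iff_right hω, pow_eq_zero_iff two_ne_zero] at hc'
      exact one_ne_zero (by linear_combination F u 0 0 * hc' - F u 1 0 * hb' - hdet : (1 : ℂ) = 0)
    · rw [Matrix.det_fin_two, hdet]
    · rw [ha', hb', hc']
      fin_cases i <;> fin_cases j <;> simp [Matrix.mul_apply]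
      · linear_combination -(ω * (F u 0 0 * g + F u 0 1)) * hdet
      · linear_combination (ω * g * (F u 0 0 * g + F u 0 1)) * hdet
      · linear_combination -(ω * (F u 1 0 * g + F u 1 1)) * hdet
      · linear_combination (ω * g * (F u 1 0 * g + F u 1 1)) * hdet

/-! ### Fluxes of catenoidal ends -/

theorem toHerm_eq_of_act_eq {P G : Matrix (Fin 2) (Fin 2) ℂ} {x : ℂ × ℝ} (hP : P.det = 1)
    (hG : G.det = 1) (hx : 0 < x.2) (h : act P x = ofHerm (G * Gᴴ)) :
    toHerm x = (P⁻¹ * G) * (P⁻¹ * G)ᴴ := by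
  have h1 : P * toHerm x * Pᴴ = G * Gᴴ := by
    rw [← toHerm_act hP hx, h, toHerm_ofHerm hG]
  have hu : IsUnit P.det := by rw [hP]; exact isUnit_one
  have hu' : IsUnit Pᴴ.det := by rw [Matrix.det_conjTranspose, hP]; simp
  have h2 : toHerm x = P⁻¹ * (P * toHerm x * Pᴴ) * (Pᴴ)⁻¹ := by
    rw [Matrix.mul_assoc P, Matrix.nonsing_inv_mul_cancel_left _ _ hu,
      Matrix.mul_nonsing_inv_cancel_right _ _ hu']
  rw [h2, h1, Matrix.conjTranspose_mul, Matrix.conjTranspose_nonsing_inv]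
  simp only [Matrix.mul_assoc]

/-- Pulling back the logarithmic derivative of the canonical representation of a catenoidal end. -/
theorem isNullImmersion_of_logDeriv {R : ℝ} {X X₀ : ℂ → ℂ × ℝ} {ψ a b c : ℂ → ℂ}
    {P : Matrix (Fin 2) (Fin 2) ℂ} {F : ℂ → Matrix (Fin 2) (Fin 2) ℂ}
    (hmem : MapsTo X (puncturedDisk R) halfSpace) (hP : P.det = 1)
    (hψ0 : ψ 0 = 0) (hinj : InjOn ψ (Metric.ball 0 R))
    (hψ : DifferentiableOn ℂ ψ (Metric.ball 0 R))
    (hX : ∀ z ∈ puncturedDisk R, act P (X z) = X₀ (ψ z))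
    (ha : DifferentiableOn ℂ a (ψ '' Metric.ball 0 R))
    (hb : DifferentiableOn ℂ b (ψ '' Metric.ball 0 R))
    (hc : DifferentiableOn ℂ c (ψ '' Metric.ball 0 R))
    (hF : ∀ u, Complex.exp u ∈ ψ '' Metric.ball 0 R →
        a (Complex.exp u) ^ 2 + b (Complex.exp u) * c (Complex.exp u) = 0 ∧
        (a (Complex.exp u) ≠ 0 ∨ b (Complex.exp u) ≠ 0 ∨ c (Complex.exp u) ≠ 0) ∧
        (F u).det = 1 ∧ X₀ (Complex.exp u) = ofHerm (F u * (F u)ᴴ) ∧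
        ∀ i j, HasDerivAt (fun v => F v i j)
          ((!![a (Complex.exp u), Complex.exp u * b (Complex.exp u);
            c (Complex.exp u) / Complex.exp u, -a (Complex.exp u)] * F u) i j) u) :
    IsNullImmersion (puncturedDisk R) X
      (fun z => deriv ψ z / ψ z * (P 1 1 * (a (ψ z) * P 0 0 + ψ z * b (ψ z) * P 1 0) -
        P 0 1 * (c (ψ z) / ψ z * P 0 0 - a (ψ z) * P 1 0)))
      (fun z => deriv ψ z / ψ z * (P 1 1 * (a (ψ z) * P 0 1 + ψ z * b (ψ z) * P 1 1) -
        P 0 1 * (c (ψ z) / ψ z * P 0 1 - a (ψ z) * P 1 1)))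
      (fun z => deriv ψ z / ψ z * (P 0 0 * (c (ψ z) / ψ z * P 0 0 - a (ψ z) * P 1 0) -
        P 1 0 * (a (ψ z) * P 0 0 + ψ z * b (ψ z) * P 1 0))) := by
  have hBo : IsOpen (Metric.ball (0 : ℂ) R) := Metric.isOpen_ball
  have hne : ∀ z ∈ puncturedDisk R, ψ z ≠ 0 := fun z hz h =>
    hz.2 (hinj hz.1 (Metric.mem_ball_self (dist_nonneg.trans_lt hz.1)) (h.trans hψ0.symm))
  have hdet : P 0 0 * P 1 1 - P 0 1 * P 1 0 = 1 := by rw [← Matrix.det_fin_two, hP]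
  have hsub : puncturedDisk R ⊆ Metric.ball 0 R := sdiff_subset
  have hψd := hψ.mono hsub
  have hψ'd := (hψ.deriv hBo).mono hsub
  have hmaps : MapsTo ψ (puncturedDisk R) (ψ '' Metric.ball 0 R) := fun z hz =>
    mem_image_of_mem ψ hz.1
  have had := ha.comp hψd hmaps
  have hbd := hb.comp hψd hmaps
  have hcd := hc.comp hψd hmaps
  have hquot := hψ'd.div hψd hne
  have hcq := hcd.div hψd hne
  have hwb := hψd.mul hbd
  refine ⟨fun z hz => hmem hz, ?_, ?_, ?_, fun z hz => ?_, fun z hz => ?_⟩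
  · exact hquot.mul ((((had.mul_const _).add (hwb.mul_const _)).const_mul _).sub
      (((hcq.mul_const _).sub (had.mul_const _)).const_mul _))
  · exact hquot.mul ((((had.mul_const _).add (hwb.mul_const _)).const_mul _).sub
      (((hcq.mul_const _).sub (had.mul_const _)).const_mul _))
  · exact hquot.mul ((((hcq.mul_const _).sub (had.mul_const _)).const_mul _).sub
      (((had.mul_const _).add (hwb.mul_const _)).const_mul _))
  · have hn := (hF (Complex.log (ψ z)) (by rw [Complex.exp_log (hne z hz)]; exact hmaps hz)).1
    rw [Complex.exp_log (hne z hz)] at hn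
    have h0 := hne z hz
    field_simp
    linear_combination (deriv ψ z * (P 0 0 * P 1 1 - P 0 1 * P 1 0) * ψ z) ^ 2 * hn
  · have h0 := hne z hz
    have hzB := hBo.mem_nhds hz.1
    have dψ := (hψ.differentiableAt hzB).hasDerivAt
    obtain ⟨u, hu⟩ : ∃ u, Complex.exp u = ψ z := ⟨_, Complex.exp_log h0⟩
    -- `F` lives on the logarithmic cover; `L` is a branch of `log ψ` near `z`, normalized to equal
    -- `u` at `z`. The logarithmic derivative of `P⁻¹ F(L)` is then `ψ' / ψ` times the conjugate by
    -- `P⁻¹` of that of `F`.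
    set L : ℂ → ℂ := fun y => u + Complex.log (ψ y / ψ z) with hL
    have hLz : L z = u := by simp [hL, h0]
    have dL : HasDerivAt L (deriv ψ z / ψ z) z := by
      have := (dψ.div_const (ψ z)).clog (by simp [h0])
      refine (this.const_add u).congr_deriv ?_
      rw [div_self h0, div_one]
    have hpd := (isOpen_puncturedDisk R).mem_nhds hz
    have hexp : ∀ y ∈ puncturedDisk R, Complex.exp (L y) = ψ y := fun y hy => by
      rw [hL, Complex.exp_add, hu, Complex.exp_log (div_ne_zero (hne y hy) h0),
        mul_div_cancel₀ _ h0]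
    have hFL : ∀ y ∈ puncturedDisk R, toHerm (X y) = (P⁻¹ * F (L y)) * (P⁻¹ * F (L y))ᴴ := by
      intro y hy
      obtain ⟨-, -, h1, h2, -⟩ := hF (L y) (by rw [hexp y hy]; exact hmaps hy)
      refine toHerm_eq_of_act_eq hP h1 (hmem hy) ?_
      rw [hX y hy, ← h2, hexp y hy]
    have hev : X =ᶠ[𝓝 z] fun y => ofHerm ((P⁻¹ * F (L y)) * (P⁻¹ * F (L y))ᴴ) := by
      filter_upwards [hpd] with y hy
      rw [← hFL y hy, ofHerm_toHerm (hmem hy)]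
    refine HasFDerivAt.congr_of_eventuallyEq ?_ hev
    have hder := (hF u (by rw [hu]; exact hmaps hz)).2.2.2.2
    rw [hu] at hder
    have hPinv : P⁻¹ = !![P 1 1, -P 0 1; -P 1 0, P 0 0] := by
      rw [Matrix.inv_def, hP, Ring.inverse_one, one_smul, Matrix.adjugate_fin_two]
    have dG : ∀ i j, HasDerivAt (fun y => (P⁻¹ * F (L y)) i j) (P⁻¹ i 0 *
        ((!![a (ψ z), ψ z * b (ψ z); c (ψ z) / ψ z, -a (ψ z)] * F u) 0 j * (deriv ψ z / ψ z)) +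
        P⁻¹ i 1 * ((!![a (ψ z), ψ z * b (ψ z); c (ψ z) / ψ z, -a (ψ z)] * F u) 1 j *
          (deriv ψ z / ψ z))) z := by
      intro i j
      have e : ∀ i, HasDerivAt (fun y => F (L y) i j)
          ((!![a (ψ z), ψ z * b (ψ z); c (ψ z) / ψ z, -a (ψ z)] * F u) i j * (deriv ψ z / ψ z)) z :=
        fun i => HasDerivAt.comp (h₂ := fun v => F v i j) z (hLz.symm ▸ hder i j) dL
      simp only [Matrix.mul_apply (M := P⁻¹), Fin.sum_univ_two]
      exact ((e 0).const_mul _).add ((e 1).const_mul _)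
    refine hasFDerivAt_ofHerm_mul_conjTranspose (hmem hz)
      (fun i j => ((dG i j).hasFDerivAt.restrictScalars ℝ)) (hFL z hz).symm
      fun v => ⟨_, _, _, killingCLM_apply _ _ _ v _, fun i j => ?_⟩
    rw [hLz]
    simp only [ContinuousLinearMap.coe_restrictScalars', ContinuousLinearMap.toSpanSingleton_apply,
      hPinv, smul_eq_mul]
    generalize deriv ψ z / ψ z = r
    generalize c (ψ z) / ψ z = c'
    generalize ψ z * b (ψ z) = b'
    generalize a (ψ z) = a'
    generalize F u = G
    simp only [Matrix.mul_apply, Fin.sum_univ_two]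
    fin_cases i <;> fin_cases j <;> simp
    · linear_combination -(v * r * (P 1 1 * (a' * G 0 0 + b' * G 1 0) -
        P 0 1 * (c' * G 0 0 - a' * G 1 0))) * hdet
    · linear_combination -(v * r * (P 1 1 * (a' * G 0 1 + b' * G 1 1) -
        P 0 1 * (c' * G 0 1 - a' * G 1 1))) * hdet
    · linear_combination -(v * r * (P 0 0 * (c' * G 0 0 - a' * G 1 0) -
        P 1 0 * (a' * G 0 0 + b' * G 1 0))) * hdet
    · linear_combination -(v * r * (P 0 0 * (c' * G 0 1 - a' * G 1 1) -
        P 1 0 * (a' * G 0 1 + b' * G 1 1))) * hdet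

/-- The flux of a Killing field through a catenoidal end only depends on the diagonal coefficient
of its generator in the basis given by the axis of the end. -/
theorem IsCatenoidalEnd.exists_hasFlux {μ : ℝ} (hμ : 0 < μ) (hμ1 : μ ≠ 1) {A B : OnePoint ℂ}
    {R : ℝ} (hR : 0 < R) {X : ℂ → ℂ × ℝ} (hE : IsCatenoidalEnd μ A B R X) :
    ∃ P : Matrix (Fin 2) (Fin 2) ℂ, P.det = 1 ∧
      P 1 1 * (homog A).1 + P 1 0 * (homog A).2 = 0 ∧
      P 0 1 * (homog B).1 + P 0 0 * (homog B).2 = 0 ∧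
      ∀ (Y : ℂ × ℝ → ℂ × ℝ) (a b c : ℂ), (∀ x : ℂ × ℝ, 0 < x.2 → Y x = killing a b c x) →
        HasFlux R X Y (-2 * π * (1 - μ ^ 2) *
          (a * (P 0 0 * P 1 1 + P 0 1 * P 1 0) - b * (P 0 0 * P 1 0) + c * (P 0 1 * P 1 1)).re) := by
  obtain ⟨P, ψ, X₀, hP, hA, hB, hψ0, hinj, hψ, hX₀, hX⟩ := hE.exists_direct
  obtain ⟨a, b, c, F, ha, hb, hc, ha0, hc0, hF⟩ := hX₀.exists_logDeriv hμ hμ1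
  have hdet : P 0 0 * P 1 1 - P 0 1 * P 1 0 = 1 := by rw [← Matrix.det_fin_two, hP]
  have h := isNullImmersion_of_logDeriv hE.1 hP hψ0 hinj hψ hX ha hb hc hF
  have hBn : Metric.ball (0 : ℂ) R ∈ 𝓝 (0 : ℂ) := Metric.ball_mem_nhds 0 hR
  have hne : ∀ z ∈ puncturedDisk R, ψ z ≠ 0 := fun z hz h =>
    hz.2 (hinj hz.1 (Metric.mem_ball_self hR) (h.trans hψ0.symm))
  have hΩ := hX₀.1
  have hΩn : ψ '' Metric.ball 0 R ∈ 𝓝 (0 : ℂ) := hΩ.mem_nhds hX₀.2.1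
  refine ⟨P, hP, hA, hB, fun Y am bm cm hY => ⟨?_, fun γ η K ε d => ?_⟩⟩
  · have hψ' := deriv_ne_zero_of_injOn hBn (hψ.analyticAt hBn) hinj hψ0
    have hcont : ContinuousAt (deriv ψ) 0 :=
      ((hψ.deriv Metric.isOpen_ball).differentiableAt hBn).continuousAt
    obtain ⟨δ, hδ, hδψ⟩ := Metric.eventually_nhds_iff.1 (hcont.eventually_ne hψ')
    have hmin : 0 < min δ R := lt_min hδ hR
    -- The circle is small enough to lie in the disk and in a neighbourhood of `0` where `ψ'` does
    -- not vanish; there `X` is an immersion.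
    refine h.exists_isFluxData (ρ := min δ R / 2) (by positivity)
      (by linarith [min_le_right δ R]) fun z hz => ?_
    have hzm : z ∈ puncturedDisk R := by
      refine ⟨?_, fun h0 => ?_⟩
      · rw [mem_ball_zero_iff, hz]
        linarith [min_le_right δ R]
      · rw [mem_singleton_iff.1 h0, norm_zero] at hz
        linarith
    have hψz : deriv ψ z ≠ 0 := hδψ (by
      rw [dist_zero_right, hz]
      linarith [min_le_left δ R])
    have h0 := hne z hzm
    have hn := (hF (Complex.log (ψ z)) (by
      rw [Complex.exp_log h0]; exact mem_image_of_mem ψ hzm.1)).2.1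
    rw [Complex.exp_log h0] at hn
    by_contra! hcon
    obtain ⟨e1, e2, e3⟩ := hcon
    have hr : deriv ψ z / ψ z ≠ 0 := div_ne_zero hψz h0
    replace e1 := (mul_eq_zero.1 e1).resolve_left hr
    replace e2 := (mul_eq_zero.1 e2).resolve_left hr
    replace e3 := (mul_eq_zero.1 e3).resolve_left hr
    -- Conjugating back by `P` recovers the entries of the original nilpotent matrix, which are not
    -- all zero.
    have n1 : a (ψ z) = 0 := by
      linear_combination (P 0 0 * P 1 1 + P 0 1 * P 1 0) * e1 + P 0 1 * P 1 1 * e3 -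
        P 0 0 * P 1 0 * e2 - a (ψ z) * (P 0 0 * P 1 1 - P 0 1 * P 1 0 + 1) * hdet
    have n2 : ψ z * b (ψ z) = 0 := by
      linear_combination -P 0 1 * (P 0 0 * e1 + P 0 1 * e3) + P 0 0 * (P 0 0 * e2 - P 0 1 * e1) -
        ψ z * b (ψ z) * (P 0 0 * P 1 1 - P 0 1 * P 1 0 + 1) * hdet
    have n3 : c (ψ z) / ψ z = 0 := by
      linear_combination P 1 1 * (P 1 0 * e1 + P 1 1 * e3) - P 1 0 * (P 1 0 * e2 - P 1 1 * e1) -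
        c (ψ z) / ψ z * (P 0 0 * P 1 1 - P 0 1 * P 1 0 + 1) * hdet
    rcases hn with hn | hn | hn
    · exact hn n1
    · exact hn ((mul_eq_zero.1 n2).resolve_left h0)
    · exact hn ((div_eq_zero_iff.1 n3).resolve_right h0)
  · rw [h.fluxIntegral_eq d hY]
    obtain rfl := h.orientation_eq d
    -- With `N = !![am, bm; cm, -am]`, cyclicity of the trace moves `P` onto `N`: the form `E(w) dw
    -- / w²` is `tr(P N P⁻¹ M)`, and the three brackets are twice the diagonal entry, the lower left
    -- entry and the upper right entry of `P N P⁻¹`. As `c'(0) = 0`, only the first bracket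
    -- contributes to `E'(0)`.
    set E : ℂ → ℂ := fun w =>
      w * a w * (2 * (am * (P 0 0 * P 1 1 + P 0 1 * P 1 0) - bm * (P 0 0 * P 1 0) +
        cm * (P 0 1 * P 1 1))) +
      w ^ 2 * b w * (2 * am * (P 1 1 * P 1 0) - bm * P 1 0 ^ 2 + cm * P 1 1 ^ 2) +
      c w * (-2 * am * (P 0 1 * P 0 0) + bm * P 0 0 ^ 2 - cm * P 0 1 ^ 2) with hEdef
    have hEd : DifferentiableOn ℂ E (ψ '' Metric.ball 0 R) :=
      ((((differentiableOn_id.mul ha).mul_const _).add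
        (((differentiableOn_id.pow 2).mul hb).mul_const _))).add (hc.mul_const _)
    have hE0 : deriv E 0 = (1 - (μ : ℂ) ^ 2) / 4 * (2 * (am * (P 0 0 * P 1 1 + P 0 1 * P 1 0) -
        bm * (P 0 0 * P 1 0) + cm * (P 0 1 * P 1 1))) := by
      have da := (ha.differentiableAt hΩn).hasDerivAt
      have db := (hb.differentiableAt hΩn).hasDerivAt
      have dc := (hc.differentiableAt hΩn).hasDerivAt
      have := ((((hasDerivAt_id (0 : ℂ)).mul da).mul_const
        (2 * (am * (P 0 0 * P 1 1 + P 0 1 * P 1 0) - bm * (P 0 0 * P 1 0) +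
        cm * (P 0 1 * P 1 1)))).add ((((hasDerivAt_id (0 : ℂ)).pow 2).mul db).mul_const
        (2 * am * (P 1 1 * P 1 0) - bm * P 1 0 ^ 2 + cm * P 1 1 ^ 2))).add (dc.mul_const
        (-2 * am * (P 0 1 * P 0 0) + bm * P 0 0 ^ 2 - cm * P 0 1 ^ 2))
      refine (this.congr_deriv ?_ : HasDerivAt E _ 0).deriv
      simp [hc0, ha0]
    have key := integral_comp_div_sq hR (d.smooth.of_le (by norm_num))
      (by simpa using d.periodic 0) d.mem hψ hinj hψ0 hΩ hEd
    rw [d.winding, hE0] at key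
    have hint : ∀ t, (2 * am * (deriv ψ (γ t) / ψ (γ t) *
          (P 1 1 * (a (ψ (γ t)) * P 0 0 + ψ (γ t) * b (ψ (γ t)) * P 1 0) -
            P 0 1 * (c (ψ (γ t)) / ψ (γ t) * P 0 0 - a (ψ (γ t)) * P 1 0))) +
        bm * (deriv ψ (γ t) / ψ (γ t) * (P 0 0 * (c (ψ (γ t)) / ψ (γ t) * P 0 0 -
            a (ψ (γ t)) * P 1 0) -
          P 1 0 * (a (ψ (γ t)) * P 0 0 + ψ (γ t) * b (ψ (γ t)) * P 1 0))) +
        cm * (deriv ψ (γ t) / ψ (γ t) * (P 1 1 * (a (ψ (γ t)) * P 0 1 +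
            ψ (γ t) * b (ψ (γ t)) * P 1 1) -
          P 0 1 * (c (ψ (γ t)) / ψ (γ t) * P 0 1 - a (ψ (γ t)) * P 1 1)))) * deriv γ t =
        E (ψ (γ t)) / ψ (γ t) ^ 2 * (deriv ψ (γ t) * deriv γ t) := by
      intro t
      have h0 := hne _ (d.mem t)
      simp only [hEdef]
      field_simp
      ring
    simp only [hint]
    rw [key]
    have e : (1 - (μ : ℂ) ^ 2) / 4 = (((1 - μ ^ 2) / 4 : ℝ) : ℂ) := by push_cast; ring
    rw [e]
    generalize am * (P 0 0 * P 1 1 + P 0 1 * P 1 0) - bm * (P 0 0 * P 1 0) +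
      cm * (P 0 1 * P 1 1) = m
    have e' : (((1 - μ ^ 2) / 4 : ℝ) : ℂ) * (2 * m) * (((-1 : ℤ) : ℂ) * (2 * π * I)) =
        ((-(1 - μ ^ 2) * π : ℝ) : ℂ) * (m * I) := by
      push_cast
      ring
    rw [e', Complex.im_ofReal_mul, Complex.mul_I_im]
    ring

/-- The diagonal coefficient of the generator of the translation along `(C, D)`, in the basis given
by the axis `(A, B)`. -/
theorem conj_generator_eq_crossRatio {A B C D : OnePoint ℂ} (hAB : A ≠ B) (hCD : C ≠ D)
    {P : Matrix (Fin 2) (Fin 2) ℂ} (hP : P.det = 1)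
    (hA : P 1 1 * (homog A).1 + P 1 0 * (homog A).2 = 0)
    (hB : P 0 1 * (homog B).1 + P 0 0 * (homog B).2 = 0) :
    -((straighten C D 0 0 * straighten C D 1 1 + straighten C D 0 1 * straighten C D 1 0) / 2) *
        (P 0 0 * P 1 1 + P 0 1 * P 1 0) -
      -(straighten C D 0 1 * straighten C D 1 1) * (P 0 0 * P 1 0) +
      straighten C D 0 0 * straighten C D 1 0 * (P 0 1 * P 1 1) =
    1 / 2 - crossRatio A C D B := by
  have h1 := bracket_ne_zero hAB
  have h2 := bracket_ne_zero hCD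
  have h1' := bracket_ne_zero hAB.symm
  have h2' := bracket_ne_zero hCD.symm
  rw [Matrix.det_fin_two] at hP
  simp only [straighten, crossRatio, Matrix.of_apply, Matrix.cons_val', Matrix.cons_val_zero,
    Matrix.cons_val_one, Matrix.cons_val_fin_one]
  simp only [bracket] at *
  generalize (homog A).1 = a₁ at *
  generalize (homog A).2 = a₂ at *
  generalize (homog B).1 = b₁ at *
  generalize (homog B).2 = b₂ at *
  generalize (homog C).1 = c₁ at *
  generalize (homog C).2 = c₂ at *
  generalize (homog D).1 = d₁ at *
  generalize (homog D).2 = d₂ at *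
  -- The equations at `A` and `B` fix `P` up to left multiplication by a diagonal matrix of
  -- determinant one. A product of an entry of the first row with one of the second is unchanged by
  -- it, hence depends only on `A` and `B`.
  have e1 : P 0 0 * P 1 1 = -(b₁ * a₂) / (a₁ * b₂ - b₁ * a₂) := by
    rw [eq_div_iff h1]
    linear_combination -(b₁ * a₂) * hP + P 0 0 * b₂ * hA - P 1 0 * a₂ * hB
  have e2 : P 0 1 * P 1 0 = -(a₁ * b₂) / (a₁ * b₂ - b₁ * a₂) := by
    rw [eq_div_iff h1]
    linear_combination -(a₁ * b₂) * hP + P 0 0 * b₂ * hA - P 1 0 * a₂ * hB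
  have e3 : P 0 0 * P 1 0 = a₁ * b₁ / (a₁ * b₂ - b₁ * a₂) := by
    rw [eq_div_iff h1]
    linear_combination (a₁ * b₁) * hP - P 0 0 * b₁ * hA + P 1 0 * a₁ * hB
  have e4 : P 0 1 * P 1 1 = a₂ * b₂ / (a₁ * b₂ - b₁ * a₂) := by
    rw [eq_div_iff h1]
    linear_combination (a₂ * b₂) * hP + P 0 1 * b₂ * hA - P 1 1 * a₂ * hB
  rw [e1, e2, e3, e4, show b₁ * a₂ - a₁ * b₂ = -(a₁ * b₂ - b₁ * a₂) by ring,
    show d₁ * c₂ - c₁ * d₂ = -(c₁ * d₂ - d₁ * c₂) by ring]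
  field_simp
  ring

theorem HasFlux.unique {R : ℝ} {X : ℂ → ℂ × ℝ} {Y : ℂ × ℝ → ℂ × ℝ} {φ φ' : ℝ}
    (h : HasFlux R X Y φ) (h' : HasFlux R X Y φ') : φ = φ' := by
  obtain ⟨⟨γ, η, K, ε, d⟩, h⟩ := h
  exact (h _ _ _ _ d).symm.trans (h'.2 _ _ _ _ d)

theorem IsCatenoidalEnd.hasFlux_translationField_and_rotationField {μ : ℝ} (hμ : 0 < μ)
    (hμ1 : μ ≠ 1) {A B : OnePoint ℂ} (hAB : A ≠ B) {R : ℝ} (hR : 0 < R) {X : ℂ → ℂ × ℝ}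
    (hE : IsCatenoidalEnd μ A B R X) {C D : OnePoint ℂ} (hCD : C ≠ D) :
    HasFlux R X (translationField C D) (π * (1 - μ ^ 2) * (2 * (crossRatio A C D B).re - 1)) ∧
      HasFlux R X (rotationField C D) (-2 * π * (1 - μ ^ 2) * (crossRatio A C D B).im) := by
  obtain ⟨P, hP, hA, hB, hflux⟩ := hE.exists_hasFlux hμ hμ1 hR
  have hx := conj_generator_eq_crossRatio hAB hCD hP hA hB
  constructor
  · have := hflux _ _ _ _ fun x => translationField_eq hCD (p := x)
    rw [hx] at this
    convert this using 1
    simp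
    ring
  · have := hflux _ _ _ _ fun x => rotationField_eq hCD (p := x)
    convert this using 1
    rw [show ∀ a b c x y z : ℂ, I * a * x - I * b * y + I * c * z = I * (a * x - b * y + c * z) from
      fun a b c x y z => by ring, hx]
    simp

/-! ### The flux polynomial -/

/-- The polynomial of two variables that describes the fluxes of a catenoidal end. -/
def catenoidalPolynomial₂ (μ : ℝ) (A B : OnePoint ℂ) : MvPolynomial (Fin 2) ℂ :=
  MvPolynomial.C (π * (1 - μ ^ 2) : ℂ) * (MvPolynomial.C (-2 / bracket B A) *
    ((MvPolynomial.X 1 * MvPolynomial.C (homog A).2 - MvPolynomial.C (homog A).1) *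
      (MvPolynomial.C (homog B).1 - MvPolynomial.X 0 * MvPolynomial.C (homog B).2)) -
    (MvPolynomial.X 0 - MvPolynomial.X 1))

/-- On the diagonal the term `X 0 - X 1` disappears and only the product of the factors vanishing at
`A` and `B` remains. -/
theorem aeval_catenoidalPolynomial₂ (μ : ℝ) {A B : OnePoint ℂ} (hAB : A ≠ B) :
    MvPolynomial.aeval (fun _ : Fin 2 => (Polynomial.X : ℂ[X])) (catenoidalPolynomial₂ μ A B) =
      catenoidalPolynomial μ A B := by
  have h := bracket_ne_zero hAB.symm
  refine Polynomial.funext fun t => ?_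
  induction A using OnePoint.rec <;> induction B using OnePoint.rec
  · exact absurd rfl hAB
  · simp [catenoidalPolynomial₂, catenoidalPolynomial, bracket, homog]
    ring
  · simp [catenoidalPolynomial₂, catenoidalPolynomial, bracket, homog]
    ring
  · simp only [bracket, homog, mul_one] at h
    simp [catenoidalPolynomial₂, catenoidalPolynomial, bracket, homog]
    field_simp
    ring

/-- Homogeneous coordinates can be chosen continuously. -/
theorem exists_tendsto_homog (C : OnePoint ℂ) : ∃ L : ℂ → ℂ × ℂ,
    Tendsto L (comap ((↑) : ℂ → OnePoint ℂ) (𝓝 C)) (𝓝 (homog C)) ∧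
      ∀ᶠ c in comap ((↑) : ℂ → OnePoint ℂ) (𝓝 C), ∃ t : ℂ, t ≠ 0 ∧ L c = (t * c, t) := by
  induction C using OnePoint.rec with
  | infty =>
    rw [OnePoint.comap_coe_nhds_infty, coclosedCompact_eq_cocompact,
      ← Metric.cobounded_eq_cocompact]
    refine ⟨fun c => (1, c⁻¹), tendsto_const_nhds.prodMk_nhds tendsto_inv₀_cobounded, ?_⟩
    filter_upwards [Bornology.isBounded_def.1 (Bornology.isBounded_singleton (x := (0 : ℂ)))] with c hc
    have hc : c ≠ 0 := hc
    exact ⟨c⁻¹, inv_ne_zero hc, by rw [inv_mul_cancel₀ hc]⟩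
  | coe z =>
    rw [OnePoint.comap_coe_nhds]
    exact ⟨fun c => (c, 1), tendsto_id.prodMk_nhds tendsto_const_nhds,
      Eventually.of_forall fun c => ⟨1, one_ne_zero, by simp⟩⟩

theorem comap_nhds_coe_prod (C D : OnePoint ℂ) :
    comap (fun c : ℂ × ℂ => ((c.1 : OnePoint ℂ), (c.2 : OnePoint ℂ))) (𝓝 (C, D)) =
      comap ((↑) : ℂ → OnePoint ℂ) (𝓝 C) ×ˢ comap ((↑) : ℂ → OnePoint ℂ) (𝓝 D) := by
  rw [nhds_prod_eq, Filter.prod_comap_comap_eq]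

/-- The cross-ratio is homogeneous of degree zero in the coordinates of `C` and of `D`. The
coordinates `(c, 1)` can thus be rescaled to ones that converge to those of `C` and `D`, even at
`∞`, and the limit is taken in the brackets. -/
theorem tendsto_catenoidalPolynomial₂ (μ : ℝ) {A B C D : OnePoint ℂ} (hAB : A ≠ B) (hCD : C ≠ D) :
    Tendsto (fun c : ℂ × ℂ =>
        MvPolynomial.eval ![c.1, c.2] (catenoidalPolynomial₂ μ A B) / (c.1 - c.2))
      (comap (fun c : ℂ × ℂ => ((c.1 : OnePoint ℂ), (c.2 : OnePoint ℂ))) (𝓝 (C, D)))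
      (𝓝 (π * (1 - μ ^ 2) * (2 * crossRatio A C D B - 1))) := by
  rw [comap_nhds_coe_prod]
  obtain ⟨L, hL, hLt⟩ := exists_tendsto_homog C
  obtain ⟨M, hM, hMt⟩ := exists_tendsto_homog D
  have hBA := bracket_ne_zero hAB.symm
  have hDC := bracket_ne_zero hCD.symm
  have hL' := hL.comp (tendsto_fst (g := comap ((↑) : ℂ → OnePoint ℂ) (𝓝 D)))
  have hM' := hM.comp (tendsto_snd (f := comap ((↑) : ℂ → OnePoint ℂ) (𝓝 C)))
  have l1 := (continuous_fst.tendsto _).comp hL'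
  have l2 := (continuous_snd.tendsto _).comp hL'
  have m1 := (continuous_fst.tendsto _).comp hM'
  have m2 := (continuous_snd.tendsto _).comp hM'
  have hden := (m1.mul l2).sub (l1.mul m2)
  have hlim := (((((m1.mul_const (homog A).2).sub (m2.const_mul (homog A).1)).div hden hDC).mul
    (((l2.const_mul (homog B).1).sub (l1.mul_const (homog B).2)).div_const
      (bracket B A))).const_mul 2 |>.sub_const 1).const_mul (π * (1 - μ ^ 2) : ℂ)
  refine Tendsto.congr' ?_ (hlim.trans (le_of_eq ?_))
  · filter_upwards [hLt.prod_inl _, hMt.prod_inr _, hden.eventually_ne hDC] with c h1 h2 h3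
    obtain ⟨t, ht, h1⟩ := h1
    obtain ⟨r, hr, h2⟩ := h2
    simp only [Function.comp_apply, Pi.div_apply, h1, h2] at h3 ⊢
    have h4 : c.1 - c.2 ≠ 0 := fun h => h3 (by linear_combination -(r * t) * h)
    have h5 : r * c.2 * t - t * c.1 * r = -(r * t * (c.1 - c.2)) := by ring
    rw [h5]
    simp [catenoidalPolynomial₂]
    field_simp
  · simp only [crossRatio]
    rfl

theorem IsCatenoidalEnd.describesFlux {μ : ℝ} (hμ : 0 < μ) (hμ1 : μ ≠ 1) {A B : OnePoint ℂ}
    (hAB : A ≠ B) {R : ℝ} (hR : 0 < R) {X : ℂ → ℂ × ℝ} (hE : IsCatenoidalEnd μ A B R X) :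
    DescribesFlux R X (catenoidalPolynomial₂ μ A B) := by
  intro C D hCD
  obtain ⟨h1, h2⟩ := hE.hasFlux_translationField_and_rotationField hμ hμ1 hAB hR hCD
  have e : (π * (1 - μ ^ 2) * (2 * crossRatio A C D B - 1) : ℂ) =
      ((π * (1 - μ ^ 2) : ℝ) : ℂ) * (2 * crossRatio A C D B - 1) := by push_cast; ring
  refine ⟨_, tendsto_catenoidalPolynomial₂ μ hAB hCD, ?_, ?_⟩
  · rw [e, Complex.re_ofReal_mul]
    simpa using h1
  · rw [e, Complex.im_ofReal_mul]
    convert h2 using 1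
    simp
    ring

theorem continuous_eval_pair (P : MvPolynomial (Fin 2) ℂ) :
    Continuous fun c : ℂ × ℂ => MvPolynomial.eval ![c.1, c.2] P := by
  refine (MvPolynomial.continuous_eval P).comp (continuous_pi fun i => ?_)
  fin_cases i
  · exact continuous_fst
  · exact continuous_snd

/-- At finite points the limit in the definition of `DescribesFlux` is the value. -/
theorem DescribesFlux.hasFlux_coe {R : ℝ} {X : ℂ → ℂ × ℝ} {P : MvPolynomial (Fin 2) ℂ}
    (hP : DescribesFlux R X P) {c d : ℂ} (hcd : c ≠ d) :
    HasFlux R X (translationField c d) (MvPolynomial.eval ![c, d] P / (c - d)).re ∧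
      HasFlux R X (rotationField c d) (-(MvPolynomial.eval ![c, d] P / (c - d)).im) := by
  obtain ⟨q, hq, hq1⟩ := hP c d fun h => hcd (OnePoint.coe_injective h)
  rw [comap_nhds_coe_prod, OnePoint.comap_coe_nhds, OnePoint.comap_coe_nhds, ← nhds_prod_eq] at hq
  have hlim : Tendsto (fun c : ℂ × ℂ => MvPolynomial.eval ![c.1, c.2] P / (c.1 - c.2))
      (𝓝 (c, d)) (𝓝 (MvPolynomial.eval ![c, d] P / (c - d))) :=
    ((continuous_eval_pair P).tendsto (c, d)).div
      ((continuous_fst.sub continuous_snd).tendsto (c, d)) (sub_ne_zero.2 hcd)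
  rwa [tendsto_nhds_unique hq hlim] at hq1

/-- The polynomial of two variables that describes the fluxes is unique on the diagonal. -/
theorem DescribesFlux.eval_eq {R : ℝ} {X : ℂ → ℂ × ℝ} {P Q : MvPolynomial (Fin 2) ℂ}
    (hP : DescribesFlux R X P) (hQ : DescribesFlux R X Q) (t : ℂ) :
    MvPolynomial.eval ![t, t] P = MvPolynomial.eval ![t, t] Q := by
  -- Translations give the real part of `P(t, d) / (t - d)` and rotations its imaginary part, so the
  -- fluxes determine `P(t, d)` for every `d ≠ t`. The value at `d = t` follows by continuity.
  have hoff : EqOn (fun d : ℂ => MvPolynomial.eval ![t, d] P)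
      (fun d : ℂ => MvPolynomial.eval ![t, d] Q) {t}ᶜ := by
    intro d hd
    have htd : t ≠ d := fun h => hd h.symm
    obtain ⟨h1, h2⟩ := hP.hasFlux_coe htd
    obtain ⟨h1', h2'⟩ := hQ.hasFlux_coe htd
    have hre := h1.unique h1'
    have him := neg_injective (h2.unique h2')
    have hquot := Complex.ext hre him
    exact (div_left_inj' (sub_ne_zero.2 htd)).1 hquot
  have hc : ∀ P : MvPolynomial (Fin 2) ℂ,
      Continuous fun d : ℂ => MvPolynomial.eval ![t, d] P := fun P => by
    refine (MvPolynomial.continuous_eval P).comp (continuous_pi fun i => ?_)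
    fin_cases i
    · exact continuous_const
    · exact continuous_id
  have hall := Continuous.ext_on (dense_compl_singleton t) (hc P) (hc Q) hoff
  exact congrFun hall t

theorem eval_aeval_X (P : MvPolynomial (Fin 2) ℂ) (t : ℂ) :
    (MvPolynomial.aeval (fun _ : Fin 2 => (Polynomial.X : ℂ[X])) P).eval t =
      MvPolynomial.eval ![t, t] P := by
  rw [MvPolynomial.aeval_def, ← Polynomial.coe_evalRingHom, MvPolynomial.hom_eval₂,
    MvPolynomial.eval, MvPolynomial.coe_eval₂Hom]
  congr 1
  · ext; simp
  · funext i
    fin_cases i <;> simp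

theorem IsCatenoidalEnd.isFluxPolynomial_iff {μ : ℝ} (hμ : 0 < μ) (hμ1 : μ ≠ 1)
    {A B : OnePoint ℂ} (hAB : A ≠ B) {R : ℝ} (hR : 0 < R) {X : ℂ → ℂ × ℝ}
    (hE : IsCatenoidalEnd μ A B R X) (Q : ℂ[X]) :
    IsFluxPolynomial R X Q ↔ Q = catenoidalPolynomial μ A B := by
  have hd := hE.describesFlux hμ hμ1 hAB hR
  constructor
  · rintro ⟨P, hP, rfl⟩
    rw [← aeval_catenoidalPolynomial₂ μ hAB]
    refine Polynomial.funext fun t => ?_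
    rw [eval_aeval_X, eval_aeval_X, hP.eval_eq hd]
  · rintro rfl
    exact ⟨_, hd, (aeval_catenoidalPolynomial₂ μ hAB).symm⟩

end Bryant

end

theorem theorem5p1 (μ : ℝ) (hμ : 0 < μ) (hμ1 : μ ≠ 1) (A B : OnePoint ℂ) (hAB : A ≠ B)
    (R : ℝ) (hR : 0 < R) (X : ℂ → ℂ × ℝ) (hE : Bryant.IsCatenoidalEnd μ A B R X) :
    (∀ C D : OnePoint ℂ, C ≠ D →
      Bryant.HasFlux R X (Bryant.translationField C D)
        (π * (1 - μ ^ 2) * (2 * (Bryant.crossRatio A C D B).re - 1))) ∧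
    (∀ C D : OnePoint ℂ, C ≠ D →
      Bryant.HasFlux R X (Bryant.rotationField C D)
        (-2 * π * (1 - μ ^ 2) * (Bryant.crossRatio A C D B).im)) ∧
    (∀ Q : Polynomial ℂ,
      Bryant.IsFluxPolynomial R X Q ↔ Q = Bryant.catenoidalPolynomial μ A B) :=
  ⟨fun _ _ hCD => (hE.hasFlux_translationField_and_rotationField hμ hμ1 hAB hR hCD).1,
    fun _ _ hCD => (hE.hasFlux_translationField_and_rotationField hμ hμ1 hAB hR hCD).2,
    hE.isFluxPolynomial_iff hμ hμ1 hAB hR⟩
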